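/- **Setting.** Let $G$ be a directed graph on the nodes $\{1,\dots,K\}$ that is topologically sorted (every edge $i\to j$ has $i<j$), let $\mathrm{pa}(k)$ be the set of parents of $k$ and $\mathrm{pre}(k)=\{1,\dots,k\}\setminus\mathrm{pa}(k)$. Assume that $G$ has no colliders: for each $k$ and all $i<j$ in $\mathrm{pa}(k)$ there is an edge $i\to j$. Let $\mathcal X_k=[0,1]^{d_k}$, $\mathcal X=\mathcal X_1\times\dots\times\mathcal X_K$ and $\mathcal X_I=\prod_{i\in I}\mathcal X_i$, all with the norm $\|\cdot\|=\|\cdot\|_\infty$, and put $$d_{\mathrm{pa}(k)}=\sum_{\ell\in\mathrm{pa}(k)}d_\ell,\qquad d_{\rm loc}=\max_{k}\bigl(\max\{2,d_k\}+d_{\mathrm{pa}(k)}\bigr),\qquad d_{\max}=\max_k\max\{2,d_k\}.$$ For $L>0$ let $\mathcal Q=\mathcal Q(G,(d_k)_k,L)$ be the set of all Borel probability measures $\mu$ on $\mathcal X$ such that $\mu(dx_1,\dots,dx_K)=\prod_{k=1}^K\mu(dx_k\mid x_{\mathrm{pa}(k)})$ and such that, for every $2\le k\le K$, the conditional distributions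 have versions (regular conditional distributions) satisfying, for all $x_{\mathrm{pa}(k)},\tilde x_{\mathrm{pa}(k)}\in\mathcal X_{\mathrm{pa}(k)}$ and all $x_k,\tilde x_k\in\mathcal X_k$, $$\mathrm{TV}\bigl(\mu(dx_k\mid x_{\mathrm{pa}(k)}),\mu(dx_k\mid\tilde x_{\mathrm{pa}(k)})\bigr)\le L\|x_{\mathrm{pa}(k)}-\tilde x_{\mathrm{pa}(k)}\|,$$ $$\mathrm{TV}\bigl(\mu(dx_{\mathrm{pre}(k)}\mid x_{\mathrm{pa}(k)}),\mu(dx_{\mathrm{pre}(k)}\mid\tilde x_{\mathrm{pa}(k)})\bigr)\le L\|x_{\mathrm{pa}(k)}-\tilde x_{\mathrm{pa}(k)}\|,$$ $$\mathrm{TV}\bigl(\mu(dx_{\mathrm{pa}(k)}\mid x_k),\mu(dx_{\mathrm{pa}(k)}\mid\tilde x_k)\bigr)\le L\|x_k-\tilde x_k\|,$$ where $\mathrm{TV}(\nu,\tilde\nu)=\sup_f\bigl(\int f\,d\nu-\int f\,d\tilde\nu\bigr)$ over measurable $f$ with $|f|\le\frac12$. Let $$V_{\mathcal Q}(n)=\inf_{E_n}\sup_{\mu\in\mathcal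 Q}\int \mathcal W(\mu,E_n)\,d\mu^{\otimes n},$$ where the infimum is over all measurable maps $E_n$ from $\mathcal X^n$ to the probability measures on $\mathcal X$ and $\mathcal W$ is the first order Wasserstein distance for $\|\cdot\|_\infty$. **Proposition.** For every $L_0>0$ there is a constant $C>0$, depending only on $L_0$, such that the following holds for all $L\ge L_0$ and all $K$, $G$, $(d_k)_{k=1}^K$ as above. If $d_{\rm loc}=\max\{2,d_k\}+d_{\mathrm{pa}(k)}$ for some $k$ with $d_k\ge2$, then for all $n\ge1$ $$V_{\mathcal Q}(n)\ \ge\ C\left(n^{-2/(2+d_{\rm loc})}+n^{-1/d_{\max}}\right).$$ -/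

import Mathlib

open MeasureTheory ProbabilityTheory
open scoped ENNReal

noncomputable section

namespace GraphicalModel

/-! ### Distances between measures and the minimax risk -/

/-- First order Wasserstein distance: infimum of the transport cost `∫ d(x, y) π(dx, dy)` over
all couplings `π` of `μ` and `ν`. -/
def wasserstein {α : Type*} [MeasurableSpace α] [PseudoEMetricSpace α] (μ ν : Measure α) :
    ℝ≥0∞ :=
  ⨅ π : {π : Measure (α × α) // π.fst = μ ∧ π.snd = ν}, ∫⁻ p, edist p.1 p.2 ∂π.1

/-- Total variation distance `sup_f (∫ f dμ - ∫ f dν)` over measurable `f` with `|f| ≤ 1/2`.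
It is only used for probability measures, for which the supremum is over a bounded set. -/
def tvDist {α : Type*} [MeasurableSpace α] (μ ν : Measure α) : ℝ :=
  ⨆ f : {f : α → ℝ // Measurable f ∧ ∀ x, |f x| ≤ 1 / 2}, (∫ x, f.1 x ∂μ - ∫ x, f.1 x ∂ν)

/-- Minimax risk `inf_E sup_{μ ∈ Q} ∫ W(μ, E) dμ^{⊗ n}`. The infimum runs over all
estimators, i.e. all measurable maps from `αⁿ` to the probability measures on `α`
(these are exactly the Markov kernels from `αⁿ` to `α`). -/
def minimaxRisk {α : Type*} [MeasurableSpace α] [PseudoEMetricSpace α]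
    (Q : Set (ProbabilityMeasure α)) (n : ℕ) : ℝ≥0∞ :=
  ⨅ E : {E : Kernel (Fin n → α) α // IsMarkovKernel E},
    ⨆ μ ∈ Q, ∫⁻ x, wasserstein (μ : Measure α) (E.1 x)
      ∂(Measure.pi fun _ : Fin n => (μ : Measure α))

/-! ### The state space and the graph

The nodes `1, …, K` are the elements of `Fin K` (so they are numbered from `0`).
All product types below carry the product σ-algebra and the sup-distance. -/

/-- `𝒳 = 𝒳₁ × ⋯ × 𝒳_K` with `𝒳_k = [0,1]^{d_k}`. -/
abbrev Space {K : ℕ} (d : Fin K → ℕ) : Type := (k : Fin K) → Fin (d k) → unitInterval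

/-- `𝒳_I = ∏_{i ∈ I} 𝒳_i`. The projection `x ↦ x_I` is `I.restrict`. -/
abbrev SubSpace {K : ℕ} (d : Fin K → ℕ) (I : Finset (Fin K)) : Type :=
  (i : I) → Fin (d i) → unitInterval

/-- The graph is topologically sorted: every edge goes from a smaller to a larger node.
In particular it is acyclic. -/
def IsTopSorted {K : ℕ} (G : Digraph (Fin K)) : Prop := ∀ i j, G.Adj i j → i < j

open Classical in
/-- The parents of a node. -/
def pa {K : ℕ} (G : Digraph (Fin K)) (k : Fin K) : Finset (Fin K) :=
  Finset.univ.filter fun l => G.Adj l k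

/-- `pre(k) = {1, …, k} \ pa(k)`. -/
def pre {K : ℕ} (G : Digraph (Fin K)) (k : Fin K) : Finset (Fin K) :=
  Finset.Iic k \ pa G k

/-- No colliders: every parent set is fully connected. -/
def NoColliders {K : ℕ} (G : Digraph (Fin K)) : Prop :=
  ∀ k, ∀ i ∈ pa G k, ∀ j ∈ pa G k, i < j → G.Adj i j

/-- `d_{pa(k)} = ∑_{ℓ ∈ pa(k)} d_ℓ`. -/
def dPa {K : ℕ} (G : Digraph (Fin K)) (d : Fin K → ℕ) (k : Fin K) : ℕ := ∑ l ∈ pa G k, d l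

/-- `d_loc = max_k (max{2, d_k} + d_{pa(k)})`. -/
def dLoc {K : ℕ} (G : Digraph (Fin K)) (d : Fin K → ℕ) : ℕ :=
  Finset.univ.sup fun k => max 2 (d k) + dPa G d k

/-- `d_max = max_k max{2, d_k}`. -/
def dMax {K : ℕ} (d : Fin K → ℕ) : ℕ := Finset.univ.sup fun k => max 2 (d k)

/-! ### Graphical models -/

/-- Integration of `f` in the `k`-th variable against `κ_k(dx_k | x_{pa(k)})`, the other variables
being kept fixed. -/
def integrateNode {K : ℕ} {d : Fin K → ℕ} {G : Digraph (Fin K)}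
    (κ : (k : Fin K) → Kernel (SubSpace d (pa G k)) (Fin (d k) → unitInterval))
    (k : Fin K) (f : Space d → ℝ≥0∞) : Space d → ℝ≥0∞ :=
  fun x => ∫⁻ y, f (Function.update x k y) ∂(κ k ((pa G k).restrict x))

/-- The iterated integral
`∫ κ_1(dx_1 | x_{pa(1)}) ∫ κ_2(dx_2 | x_{pa(2)}) ⋯ ∫ κ_K(dx_K | x_{pa(K)}) f(x_1, …, x_K)`.
For a topologically sorted graph it does not depend on the point at which the resulting function
is evaluated, since all variables are integrated out. -/
def iteratedIntegral {K : ℕ} {d : Fin K → ℕ} {G : Digraph (Fin K)}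
    (κ : (k : Fin K) → Kernel (SubSpace d (pa G k)) (Fin (d k) → unitInterval))
    (f : Space d → ℝ≥0∞) : Space d → ℝ≥0∞ :=
  (List.finRange K).foldr (integrateNode κ) f

/-- `μ ∈ 𝒫_G`: with `κ_k = μ(dx_k | x_{pa(k)})` regular conditional distributions of the `k`-th
variable given its parents, `μ(dx_1, …, dx_K) = ∏_k μ(dx_k | x_{pa(k)})`. -/
def IsGraphicalModel {K : ℕ} {d : Fin K → ℕ} (G : Digraph (Fin K)) (μ : Measure (Space d)) :
    Prop :=
  ∃ κ : (k : Fin K) → Kernel (SubSpace d (pa G k)) (Fin (d k) → unitInterval),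
    (∀ k, IsMarkovKernel (κ k)) ∧
    (∀ k, HasCondDistrib (fun x : Space d => x k) (pa G k).restrict (κ k) μ) ∧
    ∀ f : Space d → ℝ≥0∞, Measurable f → ∀ x₀ : Space d,
      ∫⁻ x, f x ∂μ = iteratedIntegral κ f x₀

/-- Under `μ`, the conditional distribution of `T` given `S` has a version (regular conditional
distribution) which is `L`-Lipschitz in total variation on the whole range space of `S`. -/
def HasTVLipCondDistrib {Ω α β : Type*} [MeasurableSpace Ω] [MeasurableSpace α]
    [PseudoMetricSpace α] [MeasurableSpace β] (L : ℝ) (T : Ω → β) (S : Ω → α) (μ : Measure Ω) :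
    Prop :=
  ∃ κ : Kernel α β, IsMarkovKernel κ ∧ HasCondDistrib T S κ μ ∧
    ∀ x x', tvDist (κ x) (κ x') ≤ L * dist x x'

/-- For all nodes `k` but the first one, the kernels `μ(dx_k | x_{pa(k)})`,
`μ(dx_{pre(k)} | x_{pa(k)})` and `μ(dx_{pa(k)} | x_k)` are `L`-Lipschitz in total variation. -/
def TVLipschitz {K : ℕ} {d : Fin K → ℕ} (G : Digraph (Fin K)) (L : ℝ) (μ : Measure (Space d)) :
    Prop :=
  ∀ k : Fin K, 0 < k.val →
    HasTVLipCondDistrib L (fun x : Space d => x k) (pa G k).restrict μ ∧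
    HasTVLipCondDistrib L (pre G k).restrict ((pa G k).restrict : Space d → _) μ ∧
    HasTVLipCondDistrib L (pa G k).restrict (fun x : Space d => x k) μ

/-- The class `𝒬` of all `μ ∈ 𝒫_G` whose kernels are TV-Lipschitz with constant `L`. -/
def tvLipModels {K : ℕ} (G : Digraph (Fin K)) (d : Fin K → ℕ) (L : ℝ) :
    Set (ProbabilityMeasure (Space d)) :=
  {μ | IsGraphicalModel G (μ : Measure (Space d)) ∧ TVLipschitz G L (μ : Measure (Space d))}

end GraphicalModel

end

/-! Both rates come from Assouad's lemma (`ofReal_le_minimaxRisk_of_signs`), applied to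
perturbations of a product of uniform measures on finite grids. The grid supports consist of `M`
cells, each containing two atoms, all atoms being `2ρ`-separated with `ρ = 1/(4r)`. A sign vector
`σ` tilts the two masses in cell `c` to `1 ± σ c * δ` times their original size (`signDensity`).
Tents of radius `ρ` extend this tilt to a density on the whole cube with Lipschitz constant `δ/ρ`.
The differences of the two tents of a cell serve as test functions: their signed sums are
1-Lipschitz, so the errors in the individual cells add up in the Wasserstein distance. Flipping one
sign changes the one-observation Hellinger affinity from `1` to at least `1 - δ²/M`, so no sign can
be recovered reliably when `n δ² ≤ M/2`, and the risk is at least `ρδ/8`.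

For the first rate the conditional law of `x_k` given its parents is tilted, with `M = r^(d_pa(k) +
d_k)`. The Lipschitz condition forces `δ ≈ ρ`, so the risk is of order `r⁻²` for `n ≈ r^(d_loc + 2)`
(`ofReal_le_minimaxRisk_of_family`). For the second rate the marginal of a single node in a product
measure is tilted. All conditional laws are then constant, so `δ = 1/2` is allowed, and the risk is
of order `r⁻¹` for `n ≈ r^(d_max)` (`ofReal_le_minimaxRisk_of_node`).

That the tilted measures belong to the class is `mem_tvLipModels`. It rests on
`hasTVLipCondDistrib_withDensity`: a Lipschitz density with respect to a product measure, bounded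
away from zero, makes the conditional law of one block of coordinates given a disjoint block
TV-Lipschitz. -/

noncomputable section

namespace GraphicalModel

/-! ### Tent functions -/

/-- The tent function of height and radius `ρ` centred at `p`. -/
def tent {Y : Type*} [PseudoMetricSpace Y] (ρ : ℝ) (p y : Y) : ℝ := max 0 (ρ - dist y p)

section Tent

variable {Y : Type*} [PseudoMetricSpace Y] {ρ : ℝ}

lemma tent_nonneg (p y : Y) : 0 ≤ tent ρ p y := le_max_left _ _

lemma tent_le (hρ : 0 ≤ ρ) (p y : Y) : tent ρ p y ≤ ρ :=
  max_le hρ (sub_le_self _ dist_nonneg)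

lemma tent_self (hρ : 0 ≤ ρ) (p : Y) : tent ρ p p = ρ := by simp [tent, hρ]

lemma tent_eq_zero {p y : Y} (h : ρ ≤ dist y p) : tent ρ p y = 0 := by
  simp [tent, h]

lemma abs_tent_sub_le (p y z : Y) : |tent ρ p y - tent ρ p z| ≤ dist y z := by
  have h1 := abs_dist_sub_le y z p
  unfold tent
  refine (abs_max_sub_max_le_max _ _ _ _).trans ?_
  simp only [sub_self, abs_zero, sub_sub_sub_cancel_left]
  rw [abs_sub_comm]
  exact max_le dist_nonneg h1

/-- The `ρ`-balls around `p` and `p'` are disjoint, and the height of a tent is bounded by the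
distance to the boundary of its ball; going from `y` to `z` costs both heights. For `y = z` this
shows that the supports are disjoint. -/
lemma tent_add_tent_le {p p' : Y} (hρ : 2 * ρ ≤ dist p p') {y z : Y} (hy : tent ρ p y ≠ 0)
    (hz : tent ρ p' z ≠ 0) : tent ρ p y + tent ρ p' z ≤ dist y z := by
  have h1 : dist p p' ≤ dist y p + dist y z + dist z p' := by
    linarith [dist_triangle p y p', dist_triangle y z p', dist_comm p y]
  unfold tent at *
  rcases max_choice 0 (ρ - dist y p) with h | h <;>
    rcases max_choice 0 (ρ - dist z p') with h' | h' <;> rw [h] at hy ⊢ <;> rw [h'] at hz ⊢ <;>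
    first | exact absurd rfl hy | exact absurd rfl hz | linarith

/-- At most one of a family of tents with well separated centres is nonzero at a given point. -/
lemma sum_tent_eq {ι : Type*} [Fintype ι] {p : ι → Y}
    (hp : ∀ i j, i ≠ j → 2 * ρ ≤ dist (p i) (p j)) (s : ι → ℝ) (y : Y) :
    (∀ i, tent ρ (p i) y = 0) ∨ ∃ i, tent ρ (p i) y ≠ 0 ∧
      ∑ j, s j * tent ρ (p j) y = s i * tent ρ (p i) y ∧ ∀ j ≠ i, tent ρ (p j) y = 0 := by
  classical
  by_cases h : ∀ i, tent ρ (p i) y = 0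
  · exact Or.inl h
  push Not at h
  obtain ⟨i, hi⟩ := h
  have hone : ∀ j ≠ i, tent ρ (p j) y = 0 := by
    intro j hj
    by_contra hj0
    have := tent_add_tent_le (hp i j hj.symm) hi hj0
    rw [dist_self] at this
    have h1 := tent_nonneg (ρ := ρ) (p j) y
    have h2 := tent_nonneg (ρ := ρ) (p i) y
    exact hj0 (le_antisymm (by linarith) h1)
  exact Or.inr ⟨i, hi, Finset.sum_eq_single i (fun j _ hj => by simp [hone j hj]) (by simp), hone⟩

lemma abs_mul_tent_le {s : ℝ} (hs : |s| ≤ 1) (p y : Y) : |s * tent ρ p y| ≤ tent ρ p y := by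
  rw [abs_mul, abs_of_nonneg (tent_nonneg (ρ := ρ) p y)]
  exact mul_le_of_le_one_left (tent_nonneg _ _) hs

lemma abs_sum_tent_le {ι : Type*} [Fintype ι] {p : ι → Y} (hρ : 0 ≤ ρ)
    (hp : ∀ i j, i ≠ j → 2 * ρ ≤ dist (p i) (p j)) {s : ι → ℝ} (hs : ∀ i, |s i| ≤ 1) (y : Y) :
    |∑ i, s i * tent ρ (p i) y| ≤ ρ := by
  rcases sum_tent_eq hp s y with h | ⟨i, -, h, -⟩
  · simpa [h] using hρ
  · rw [h]
    exact (abs_mul_tent_le (hs i) _ _).trans (tent_le hρ _ _)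

/-- A signed sum of tents around well separated points is `1`-Lipschitz. -/
lemma abs_sum_tent_sub_le {ι : Type*} [Fintype ι] {p : ι → Y}
    (hp : ∀ i j, i ≠ j → 2 * ρ ≤ dist (p i) (p j)) {s : ι → ℝ} (hs : ∀ i, |s i| ≤ 1) (y z : Y) :
    |∑ i, s i * tent ρ (p i) y - ∑ i, s i * tent ρ (p i) z| ≤ dist y z := by
  have hsingle : ∀ i, |s i * tent ρ (p i) y - s i * tent ρ (p i) z| ≤ dist y z := by
    intro i
    rw [← mul_sub, abs_mul]
    calc |s i| * |tent ρ (p i) y - tent ρ (p i) z|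
        ≤ 1 * dist y z := mul_le_mul (hs i) (abs_tent_sub_le _ _ _) (abs_nonneg _) zero_le_one
      _ = _ := one_mul _
  rcases sum_tent_eq hp s y with hy | ⟨i, hi0, hi, hi'⟩ <;>
    rcases sum_tent_eq hp s z with hz | ⟨j, hj0, hj, hj'⟩
  · simp [hy, hz]
  · rw [hj]
    simpa [hy] using hsingle j
  · rw [hi]
    simpa [hz] using hsingle i
  · rw [hi, hj]
    by_cases hij : i = j
    · subst hij
      exact hsingle i
    · calc _ ≤ |s i * tent ρ (p i) y| + |s j * tent ρ (p j) z| := abs_sub _ _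
        _ ≤ tent ρ (p i) y + tent ρ (p j) z :=
          add_le_add (abs_mul_tent_le (hs i) _ _) (abs_mul_tent_le (hs j) _ _)
        _ ≤ _ := tent_add_tent_le (hp i j hij) hi0 hj0

lemma continuous_tent (p : Y) : Continuous (tent ρ p) := by
  unfold tent; fun_prop

end Tent

/-! ### Lower bounds for the Wasserstein distance and the minimax risk -/

section Assouad

variable {Ω : Type*} [MeasurableSpace Ω] [PseudoMetricSpace Ω]

/-- The easy half of Kantorovich duality: integrate the Lipschitz bound against an arbitrary
coupling. Boundedness only provides integrability. -/
lemma ofReal_integral_sub_le_wasserstein {μ ν : Measure Ω} [IsProbabilityMeasure μ]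
    [IsProbabilityMeasure ν] {f : Ω → ℝ} (hf : Measurable f) {B : ℝ} (hB : ∀ x, |f x| ≤ B)
    (hlip : ∀ x y, |f x - f y| ≤ dist x y) :
    ENNReal.ofReal (∫ x, f x ∂μ - ∫ x, f x ∂ν) ≤ wasserstein μ ν := by
  refine le_iInf fun ⟨π, h1, h2⟩ => ?_
  have hπ : IsProbabilityMeasure π := by
    constructor
    rw [← Measure.fst_univ, h1, measure_univ]
  have hi1 : Integrable (fun p : Ω × Ω => f p.1) π :=
    Integrable.of_bound (hf.comp measurable_fst).aestronglyMeasurable B (ae_of_all _ fun p => hB _)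
  have hi2 : Integrable (fun p : Ω × Ω => f p.2) π :=
    Integrable.of_bound (hf.comp measurable_snd).aestronglyMeasurable B (ae_of_all _ fun p => hB _)
  have e1 : ∫ x, f x ∂μ = ∫ p, f p.1 ∂π := by
    rw [← h1, Measure.fst, integral_map measurable_fst.aemeasurable hf.aestronglyMeasurable]
  have e2 : ∫ x, f x ∂ν = ∫ p, f p.2 ∂π := by
    rw [← h2, Measure.snd, integral_map measurable_snd.aemeasurable hf.aestronglyMeasurable]
  rw [e1, e2, ← integral_sub hi1 hi2]
  have h3 : ∫ p, (f p.1 - f p.2) ∂π ≤ ∫ p, |f p.1 - f p.2| ∂π :=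
    integral_mono (hi1.sub hi2) (hi1.sub hi2).abs fun p => le_abs_self _
  refine (ENNReal.ofReal_le_ofReal h3).trans ?_
  rw [ofReal_integral_eq_lintegral_ofReal (f := fun p : Ω × Ω => |f p.1 - f p.2|)
    (hi1.sub hi2).abs (ae_of_all _ fun p => abs_nonneg _)]
  refine lintegral_mono fun p => ?_
  rw [edist_dist]
  exact ENNReal.ofReal_le_ofReal (hlip _ _)

/-- Choosing `s c` as the sign of the `c`-th difference turns the sum of absolute values into the
difference of integrals of one 1-Lipschitz function, so nothing is lost in the number of cells. -/
lemma ofReal_sum_abs_le_wasserstein {C : Type*} [Fintype C] {ψ : C → Ω → ℝ}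
    (hψ : ∀ c, Measurable (ψ c)) {B : ℝ} (hB : ∀ c x, |ψ c x| ≤ B)
    (hlip : ∀ s : C → ℝ, (∀ c, |s c| ≤ 1) →
      ∀ x y, |∑ c, s c * ψ c x - ∑ c, s c * ψ c y| ≤ dist x y)
    (μ ν : Measure Ω) [IsProbabilityMeasure μ] [IsProbabilityMeasure ν] :
    ENNReal.ofReal (∑ c, |∫ x, ψ c x ∂μ - ∫ x, ψ c x ∂ν|) ≤ wasserstein μ ν := by
  let s : C → ℝ := fun c => SignType.sign (∫ x, ψ c x ∂μ - ∫ x, ψ c x ∂ν)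
  have hs : ∀ c, |s c| ≤ 1 := by
    intro c
    simp only [s]
    rcases SignType.sign (∫ x, ψ c x ∂μ - ∫ x, ψ c x ∂ν) with _ | _ | _ <;> simp
  have hint : ∀ (m : Measure Ω) [IsProbabilityMeasure m] (c : C), Integrable (ψ c) m :=
    fun m _ c => Integrable.of_bound (hψ c).aestronglyMeasurable B (ae_of_all _ fun p => hB _ _)
  have key : ∀ (m : Measure Ω) [IsProbabilityMeasure m],
      ∫ x, ∑ c, s c * ψ c x ∂m = ∑ c, s c * ∫ x, ψ c x ∂m := by
    intro m _
    rw [integral_finsetSum _ fun c _ => (hint m c).const_mul _]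
    simp_rw [integral_const_mul]
  have h := ofReal_integral_sub_le_wasserstein (μ := μ) (ν := ν) (f := fun x => ∑ c, s c * ψ c x)
    (by fun_prop) (B := ∑ _c : C, B)
    (fun x => (Finset.abs_sum_le_sum_abs _ _).trans (Finset.sum_le_sum fun c _ => by
      rw [abs_mul]
      exact (mul_le_of_le_one_left (abs_nonneg _) (hs c)).trans (hB c x)))
    (hlip s hs)
  rw [key μ, key ν, ← Finset.sum_sub_distrib] at h
  convert h using 3 with c
  rw [← mul_sub]
  simp only [s]
  rw [sign_mul_self]

/-- Weighted AM-GM. After integration against two probability densities the last term is `1/4`, so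
an affinity of at least `1/2` leaves `∫ min ≥ 1/8`. -/
lemma sqrt_mul_le_min {a b : ℝ} (ha : 0 ≤ a) (hb : 0 ≤ b) :
    √(a * b) ≤ 2 * min a b + (a + b) / 8 := by
  rw [Real.sqrt_le_left (by have := le_min ha hb; positivity)]
  rcases le_total a b with h | h
  · rw [min_eq_left h]
    nlinarith [sq_nonneg (17 * a / 8 - b / 8)]
  · rw [min_eq_right h]
    nlinarith [sq_nonneg (17 * b / 8 - a / 8)]

end Assouad

/-! ### Densities of product measures. -/

lemma lintegral_pi_prod {ι : Type*} [Fintype ι] {X : ι → Type*} [∀ i, MeasurableSpace (X i)]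
    (ν : ∀ i, Measure (X i)) [∀ i, IsProbabilityMeasure (ν i)] {g : ∀ i, X i → ℝ≥0∞}
    (hg : ∀ i, Measurable (g i)) :
    ∫⁻ x, ∏ i, g i (x i) ∂(Measure.pi ν) = ∏ i, ∫⁻ y, g i y ∂(ν i) := by
  have h := lintegral_prod_eq_prod_lintegral_of_indepFun Finset.univ
    (fun i (x : ∀ i, X i) => g i (x i)) (iIndepFun_pi (μ := ν) fun i => (hg i).aemeasurable)
    (fun i => (hg i).comp (measurable_pi_apply i))
  rw [h]
  exact Finset.prod_congr rfl fun i _ => (measurePreserving_eval ν i).lintegral_comp (hg i)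

lemma pi_withDensity {ι : Type*} [Fintype ι] {X : ι → Type*} [∀ i, MeasurableSpace (X i)]
    (ν : ∀ i, Measure (X i)) [∀ i, IsProbabilityMeasure (ν i)] {g : ∀ i, X i → ℝ≥0∞}
    (hg : ∀ i, Measurable (g i)) [∀ i, SigmaFinite ((ν i).withDensity (g i))] :
    Measure.pi (fun i => (ν i).withDensity (g i)) =
      (Measure.pi ν).withDensity fun x => ∏ i, g i (x i) := by
  refine Measure.pi_eq fun s hs => ?_
  rw [withDensity_apply _ (MeasurableSet.univ_pi hs),
    ← lintegral_indicator (MeasurableSet.univ_pi hs)]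
  have h : ∀ x, (Set.univ.pi s).indicator (fun x => ∏ i, g i (x i)) x =
      ∏ i, (s i).indicator (g i) (x i) := by
    intro x
    by_cases hx : x ∈ Set.univ.pi s
    · rw [Set.indicator_of_mem hx]
      exact Finset.prod_congr rfl fun i _ => (Set.indicator_of_mem (hx i trivial) _).symm
    · rw [Set.indicator_of_notMem hx]
      simp only [Set.mem_pi, Set.mem_univ, true_implies, not_forall] at hx
      obtain ⟨i, hi⟩ := hx
      exact (Finset.prod_eq_zero (Finset.mem_univ i) (Set.indicator_of_notMem hi _)).symm
  simp_rw [h]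
  rw [lintegral_pi_prod ν fun i => (hg i).indicator (hs i)]
  refine Finset.prod_congr rfl fun i _ => ?_
  rw [lintegral_indicator (hs i), withDensity_apply _ (hs i)]

/-! ### Two-point testing and Assouad's lemma. -/

section Assouad

variable {Ω : Type*} [MeasurableSpace Ω]

lemma integrable_of_bdd {u : Measure Ω} [IsProbabilityMeasure u] {f : Ω → ℝ} (hf : Measurable f)
    {B : ℝ} (h0 : ∀ x, 0 ≤ f x) (hB : ∀ x, f x ≤ B) : Integrable f u :=
  Integrable.of_bound hf.aestronglyMeasurable B
    (ae_of_all _ fun x => by rw [Real.norm_of_nonneg (h0 x)]; exact hB x)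

/-- The affinity is multiplicative over independent observations, whereas the integral of the
minimum is not; `sqrt_mul_le_min` passes from one to the other. -/
lemma ofReal_le_lintegral_min {u : Measure Ω} [IsProbabilityMeasure u] {q q' : Ω → ℝ}
    (hq : Measurable q) (hq' : Measurable q') (h0 : ∀ x, 0 ≤ q x) (h0' : ∀ x, 0 ≤ q' x)
    {B : ℝ} (hB : ∀ x, q x ≤ B) (hB' : ∀ x, q' x ≤ B) (h1 : ∫ x, q x ∂u = 1)
    (h1' : ∫ x, q' x ∂u = 1) {n : ℕ} (haff : 1 / 2 ≤ (∫ x, √(q x * q' x) ∂u) ^ n) :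
    ENNReal.ofReal (1 / 8) ≤ ∫⁻ x : Fin n → Ω, ENNReal.ofReal
      (min (∏ i, q (x i)) (∏ i, q' (x i))) ∂(Measure.pi fun _ => u) := by
  have hi : Integrable (fun x : Fin n → Ω => ∏ i, q (x i)) (Measure.pi fun _ => u) :=
    Integrable.fintype_prod fun _ => integrable_of_bdd hq h0 hB
  have hi' : Integrable (fun x : Fin n → Ω => ∏ i, q' (x i)) (Measure.pi fun _ => u) :=
    Integrable.fintype_prod fun _ => integrable_of_bdd hq' h0' hB'
  have hp : ∀ x : Fin n → Ω, 0 ≤ ∏ i, q (x i) := fun x => Finset.prod_nonneg fun i _ => h0 _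
  have hp' : ∀ x : Fin n → Ω, 0 ≤ ∏ i, q' (x i) := fun x => Finset.prod_nonneg fun i _ => h0' _
  have hii : Integrable (fun x : Fin n → Ω => ∏ i, q (x i) + ∏ i, q' (x i))
      (Measure.pi fun _ => u) := hi.add hi'
  have hm : Integrable (fun x : Fin n → Ω => min (∏ i, q (x i)) (∏ i, q' (x i)))
      (Measure.pi fun _ => u) := hi.inf hi'
  have he : ∫ x : Fin n → Ω, ∏ i, q (x i) ∂(Measure.pi fun _ => u) = 1 := by
    rw [integral_fintype_prod_eq_pow (fun x => q x), h1, one_pow]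
  have he' : ∫ x : Fin n → Ω, ∏ i, q' (x i) ∂(Measure.pi fun _ => u) = 1 := by
    rw [integral_fintype_prod_eq_pow (fun x => q' x), h1', one_pow]
  have hs : ∫ x : Fin n → Ω, ∏ i, √(q (x i) * q' (x i)) ∂(Measure.pi fun _ => u) =
      (∫ x, √(q x * q' x) ∂u) ^ n := by
    rw [integral_fintype_prod_eq_pow (fun x => √(q x * q' x)), Fintype.card_fin]
  rw [← hs] at haff
  have hle : ∫ x : Fin n → Ω, ∏ i, √(q (x i) * q' (x i)) ∂(Measure.pi fun _ => u) ≤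
      ∫ x : Fin n → Ω, (2 * min (∏ i, q (x i)) (∏ i, q' (x i)) +
        (∏ i, q (x i) + ∏ i, q' (x i)) / 8) ∂(Measure.pi fun _ => u) := by
    refine integral_mono_of_nonneg
      (ae_of_all _ fun x => Finset.prod_nonneg fun i _ => Real.sqrt_nonneg _)
      ((hm.const_mul 2).add (hii.div_const 8)) (ae_of_all _ fun x => ?_)
    have : ∏ i, √(q (x i) * q' (x i)) = √((∏ i, q (x i)) * ∏ i, q' (x i)) := by
      rw [← Finset.prod_mul_distrib, Real.sqrt_prod _ fun i _ => mul_nonneg (h0 _) (h0' _)]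
    simp only [this]
    exact sqrt_mul_le_min (hp x) (hp' x)
  rw [integral_add (hm.const_mul 2) (hii.div_const 8), integral_const_mul,
    integral_div, integral_add hi hi', he, he'] at hle
  rw [← ofReal_integral_eq_lintegral_ofReal hm (ae_of_all _ fun x => le_min (hp x) (hp' x))]
  exact ENNReal.ofReal_le_ofReal (by linarith)

/-- Le Cam's argument: no estimate `e x` is close to both `a` and `-a`, and both densities dominate
their minimum. -/
lemma two_point_bound {α : Type*} [MeasurableSpace α] {m : Measure α} {P P' : α → ℝ}
    (hP : Measurable P) (h0 : ∀ x, 0 ≤ P x) (h0' : ∀ x, 0 ≤ P' x)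
    {a b : ℝ} (hmin : ENNReal.ofReal b ≤ ∫⁻ x, ENNReal.ofReal (min (P x) (P' x)) ∂m)
    {e : α → ℝ} (he : Measurable e) :
    ENNReal.ofReal (2 * |a| * b) ≤ ∫⁻ x, ENNReal.ofReal (|a - e x| * P x) ∂m +
      ∫⁻ x, ENNReal.ofReal (|-a - e x| * P' x) ∂m := by
  rw [← lintegral_add_left (by fun_prop), ENNReal.ofReal_mul (by positivity)]
  refine (mul_le_mul_right hmin _).trans ?_
  rw [← lintegral_const_mul' _ _ ENNReal.ofReal_ne_top]
  refine lintegral_mono fun x => ?_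
  rw [← ENNReal.ofReal_mul (by positivity), ← ENNReal.ofReal_add
    (mul_nonneg (abs_nonneg _) (h0 x)) (mul_nonneg (abs_nonneg _) (h0' x))]
  refine ENNReal.ofReal_le_ofReal ?_
  have h1 : 2 * |a| ≤ |a - e x| + |-a - e x| := by
    have := abs_sub (a - e x) (-a - e x)
    rw [show a - e x - (-a - e x) = 2 * a by ring, abs_mul, abs_two] at this
    exact this
  calc 2 * |a| * min (P x) (P' x) ≤ (|a - e x| + |-a - e x|) * min (P x) (P' x) :=
        mul_le_mul_of_nonneg_right h1 (le_min (h0 x) (h0' x))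
    _ = |a - e x| * min (P x) (P' x) + |-a - e x| * min (P x) (P' x) := by ring
    _ ≤ _ := add_le_add (mul_le_mul_of_nonneg_left (min_le_left _ _) (abs_nonneg _))
        (mul_le_mul_of_nonneg_left (min_le_right _ _) (abs_nonneg _))

variable [PseudoMetricSpace Ω]

/-- Assouad's lemma for the Wasserstein risk: the hypotheses are densities `q σ` indexed by sign
vectors, and the separation is measured by test functions `ψ c` whose signed sums are
`1`-Lipschitz. -/
theorem ofReal_le_minimaxRisk_of_signs {C : Type*} [Fintype C] [DecidableEq C]
    {Q : Set (ProbabilityMeasure Ω)} {u : Measure Ω} [IsProbabilityMeasure u]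
    {ψ : C → Ω → ℝ} (hψ : ∀ c, Measurable (ψ c)) {B : ℝ} (hB : ∀ c x, |ψ c x| ≤ B)
    (hlip : ∀ s : C → ℝ, (∀ c, |s c| ≤ 1) →
      ∀ x y, |∑ c, s c * ψ c x - ∑ c, s c * ψ c y| ≤ dist x y)
    {q : (C → ℤˣ) → Ω → ℝ} (hq : ∀ σ, Measurable (q σ)) (hq0 : ∀ σ x, 0 ≤ q σ x) {B' : ℝ}
    (hqB : ∀ σ x, q σ x ≤ B')
    (hQ : ∀ σ, ∃ μ ∈ Q, (μ : Measure Ω) = u.withDensity fun x => ENNReal.ofReal (q σ x))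
    {θ : ℝ} (hθ : 0 ≤ θ)
    (hmean : ∀ σ c, ∫ x, q σ x * ψ c x ∂u = ((σ c : ℤ) : ℝ) * θ) {n : ℕ}
    (haff : ∀ σ c, 1 / 2 ≤ (∫ x, √(q σ x * q (σ * Pi.mulSingle c (-1)) x) ∂u) ^ n) :
    ENNReal.ofReal (Fintype.card C * θ / 8) ≤ minimaxRisk Q n := by
  refine le_iInf fun ⟨E, hE⟩ => ?_
  choose μ hμQ hμ using hQ
  set R : ℝ≥0∞ := ⨆ μ ∈ Q, ∫⁻ x, wasserstein (μ : Measure Ω) (E x)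
      ∂(Measure.pi fun _ : Fin n => (μ : Measure Ω)) with hR
  have h1 : ∀ σ, ∫ x, q σ x ∂u = 1 := by
    intro σ
    have h : (μ σ : Measure Ω) Set.univ = 1 := measure_univ
    rw [hμ, withDensity_apply _ MeasurableSet.univ, Measure.restrict_univ,
      ← ofReal_integral_eq_lintegral_ofReal (integrable_of_bdd (hq σ) (hq0 σ) (hqB σ))
        (ae_of_all _ (hq0 σ)), ENNReal.ofReal_eq_one] at h
    exact h
  let U : Measure (Fin n → Ω) := Measure.pi fun _ => u
  let e : C → (Fin n → Ω) → ℝ := fun c x => ∫ y, ψ c y ∂(E x)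
  have he : ∀ c, Measurable (e c) := fun c =>
    ((hψ c).stronglyMeasurable.integral_kernel (κ := E)).measurable
  let I : (C → ℤˣ) → C → ℝ≥0∞ := fun σ c =>
    ∫⁻ x, ENNReal.ofReal (|((σ c : ℤ) : ℝ) * θ - e c x| * ∏ i, q σ (x i)) ∂U
  have hprod : ∀ σ, Measurable fun x : Fin n → Ω => ∏ i, q σ (x i) := fun σ =>
    Finset.measurable_prod _ fun i _ => (hq σ).comp (measurable_pi_apply i)
  have hprod0 : ∀ σ (x : Fin n → Ω), 0 ≤ ∏ i, q σ (x i) := fun σ x =>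
    Finset.prod_nonneg fun i _ => hq0 _ _
  -- `e c` is the estimate of `∫ ψ c` induced by `E`; `I σ c` is its mean error under `n` draws from
  -- the `σ`-th model, written with respect to the common measure `U`.
  have hrisk : ∀ σ, ∑ c, I σ c ≤ R := by
    intro σ
    refine le_trans ?_ (le_iSup₂_of_le (f := fun (μ : ProbabilityMeasure Ω) (_ : μ ∈ Q) =>
      ∫⁻ x, wasserstein (μ : Measure Ω) (E x) ∂(Measure.pi fun _ : Fin n => (μ : Measure Ω)))
      (μ σ) (hμQ σ) le_rfl)
    have hlow : ∀ x, ENNReal.ofReal (∑ c, |((σ c : ℤ) : ℝ) * θ - e c x|) ≤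
        wasserstein (μ σ : Measure Ω) (E x) := by
      intro x
      have := ofReal_sum_abs_le_wasserstein hψ hB hlip (μ σ : Measure Ω) (E x)
      convert this using 5 with c
      rw [hμ, ← hmean, integral_withDensity_eq_integral_toReal_smul
        (by have := hq σ; fun_prop) (ae_of_all _ fun x => ENNReal.ofReal_lt_top)]
      simp [ENNReal.toReal_ofReal (hq0 σ _)]
    refine le_trans ?_ (lintegral_mono hlow)
    have : SigmaFinite (u.withDensity fun x => ENNReal.ofReal (q σ x)) := by
      rw [← hμ]; infer_instance
    have hpi : (Measure.pi fun _ : Fin n => (μ σ : Measure Ω)) =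
        U.withDensity fun x => ∏ i, ENNReal.ofReal (q σ (x i)) := by
      simp_rw [hμ]
      exact pi_withDensity (fun _ : Fin n => u) fun _ => by have := hq σ; fun_prop
    rw [hpi, lintegral_withDensity_eq_lintegral_mul _
      (Finset.measurable_prod _ fun i _ => by have := hq σ; fun_prop) (by fun_prop)]
    rw [← lintegral_finsetSum _ fun c _ => by
      have := hprod σ; have := he c; fun_prop]
    refine lintegral_mono fun x => ?_
    rw [Pi.mul_apply, ← ENNReal.ofReal_prod_of_nonneg fun i _ => hq0 _ _,
      ← ENNReal.ofReal_mul (hprod0 σ x), ← ENNReal.ofReal_sum_of_nonneg fun c _ =>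
      mul_nonneg (abs_nonneg _) (hprod0 σ x), ← Finset.sum_mul, mul_comm]
  have hpair : ∀ σ c, ENNReal.ofReal (θ / 4) ≤ I σ c + I (σ * Pi.mulSingle c (-1)) c := by
    intro σ c
    have h := two_point_bound (a := ((σ c : ℤ) : ℝ) * θ) (hprod σ) (hprod0 σ)
      (hprod0 (σ * Pi.mulSingle c (-1)))
      (ofReal_le_lintegral_min (hq σ) (hq _) (hq0 σ) (hq0 _) (hqB σ) (hqB _) (h1 σ) (h1 _)
        (haff σ c)) (he c)
    have habs : 2 * |((σ c : ℤ) : ℝ) * θ| * (1 / 8) = θ / 4 := by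
      rcases Int.units_eq_one_or (σ c) with hc | hc <;> simp [hc, abs_of_nonneg hθ] <;> ring
    rw [habs] at h
    simpa [I, U] using h
  clear_value I
  -- Flipping the sign at `c` permutes the sign vectors, so summing `hpair` over all of them counts
  -- each `I σ c` twice.
  have hsum : ∀ c, ENNReal.ofReal (θ / 8) * Fintype.card (C → ℤˣ) ≤ ∑ σ, I σ c := by
    intro c
    have h2 : ∑ σ, I (σ * Pi.mulSingle c (-1)) c = ∑ σ, I σ c :=
      Fintype.sum_equiv (Equiv.mulRight (Pi.mulSingle c (-1) : C → ℤˣ)) _ _ fun σ => by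
        rw [Equiv.coe_mulRight]
    have h3 : ∑ _σ : C → ℤˣ, ENNReal.ofReal (θ / 4) ≤ 2 * ∑ σ, I σ c := by
      rw [two_mul]
      nth_rewrite 2 [← h2]
      rw [← Finset.sum_add_distrib]
      exact Finset.sum_le_sum fun σ _ => hpair σ c
    rw [Finset.sum_const, Finset.card_univ, nsmul_eq_mul, show θ / 4 = 2 * (θ / 8) by ring,
      ENNReal.ofReal_mul two_pos.le, ENNReal.ofReal_ofNat, mul_left_comm] at h3
    rw [mul_comm]
    exact (ENNReal.mul_le_mul_iff_right two_ne_zero ENNReal.ofNat_ne_top).1 h3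
  -- The supremum of the risk dominates its average over the sign vectors.
  have htot : ENNReal.ofReal (Fintype.card C * θ / 8) * Fintype.card (C → ℤˣ) ≤
      R * Fintype.card (C → ℤˣ) := by
    calc ENNReal.ofReal (Fintype.card C * θ / 8) * Fintype.card (C → ℤˣ)
        = ∑ _c : C, ENNReal.ofReal (θ / 8) * Fintype.card (C → ℤˣ) := by
          rw [Finset.sum_const, Finset.card_univ, nsmul_eq_mul, mul_div_assoc,
            ENNReal.ofReal_mul (Nat.cast_nonneg _), ENNReal.ofReal_natCast, mul_assoc]
      _ ≤ ∑ c, ∑ σ, I σ c := Finset.sum_le_sum fun c _ => hsum c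
      _ = ∑ σ, ∑ c, I σ c := Finset.sum_comm
      _ ≤ ∑ _σ : C → ℤˣ, R := Finset.sum_le_sum fun σ _ => hrisk σ
      _ = R * Fintype.card (C → ℤˣ) := by
          rw [Finset.sum_const, Finset.card_univ, nsmul_eq_mul, mul_comm]
  exact (ENNReal.mul_le_mul_iff_left (Nat.cast_ne_zero.2 Fintype.card_ne_zero)
    (ENNReal.natCast_ne_top _)).1 htot

end Assouad

/-! ### Conditional distributions under a Lipschitz density. -/

section Bounds

variable {Ω : Type*} [MeasurableSpace Ω] {u : Measure Ω} [IsProbabilityMeasure u]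

lemma integrable_of_mem_Icc {f : Ω → ℝ} (hf : Measurable f) {a b : ℝ}
    (h : ∀ x, f x ∈ Set.Icc a b) : Integrable f u :=
  Integrable.of_bound hf.aestronglyMeasurable (max |a| |b|)
    (ae_of_all _ fun x => abs_le_max_abs_abs (h x).1 (h x).2)

lemma integral_mem_Icc {f : Ω → ℝ} (hf : Measurable f) {a b : ℝ}
    (h : ∀ x, f x ∈ Set.Icc a b) : ∫ x, f x ∂u ∈ Set.Icc a b := by
  have hi := integrable_of_mem_Icc (u := u) hf h
  constructor
  · simpa using integral_mono (integrable_const a) hi fun x => (h x).1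
  · simpa using integral_mono hi (integrable_const b) fun x => (h x).2

lemma integral_sub_integral_le {f g : Ω → ℝ} (hf : Integrable f u) (hg : Integrable g u) {c : ℝ}
    (h : ∀ x, |f x - g x| ≤ c) : |∫ x, f x ∂u - ∫ x, g x ∂u| ≤ c := by
  rw [← integral_sub hf hg]
  refine (abs_integral_le_integral_abs).trans ?_
  simpa using integral_mono (hf.sub hg).abs (integrable_const c) h

end Bounds

/-- `m s x` replaces the value of the variable `S` at `x` by `s`; if `s` is drawn from `ρ`,
this leaves `u` invariant. -/
structure IsResampling {Ω α : Type*} [MeasurableSpace Ω] [MeasurableSpace α]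
    [PseudoMetricSpace Ω] [PseudoMetricSpace α] (u : Measure Ω) (S : Ω → α) (ρ : Measure α)
    (m : α → Ω → Ω) : Prop where
  measurable : Measurable S
  measurable_uncurry : Measurable fun p : α × Ω => m p.1 p.2
  lintegral : ∀ F : Ω → ℝ≥0∞, Measurable F →
    ∫⁻ s, ∫⁻ x, F (m s x) ∂u ∂ρ = ∫⁻ x, F x ∂u
  apply : ∀ s x, S (m s x) = s
  dist_left : ∀ s s' x, dist (m s x) (m s' x) ≤ dist s s'

/-- The constant is `2 + 3 * 2`, from `1/r ≤ 2` and `p'/r' ≤ 3`. The bound `|f| ≤ 1/2` in `tvDist`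
later halves it to the `4` in `4 * Λ ≤ L`. -/
lemma abs_div_sub_div_le {p r p' r' c : ℝ} (hp' : p' ∈ Set.Icc (1 / 2 : ℝ) (3 / 2))
    (hr : r ∈ Set.Icc (1 / 2 : ℝ) (3 / 2)) (hr' : r' ∈ Set.Icc (1 / 2 : ℝ) (3 / 2))
    (h : |p - p'| ≤ c) (h' : |r - r'| ≤ c) : |p / r - p' / r'| ≤ 8 * c := by
  have hc : 0 ≤ c := (abs_nonneg _).trans h
  have hr0 : 0 < r := by linarith [hr.1]
  have hr0' : 0 < r' := by linarith [hr'.1]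
  have e : p / r - p' / r' = (p - p') / r + p' / r' * ((r' - r) / r) := by field_simp; ring
  have h1 : |(p - p') / r| ≤ 2 * c := by
    rw [abs_div, abs_of_pos hr0, div_le_iff₀ hr0]
    nlinarith [hr.1]
  have h2 : |(r' - r) / r| ≤ 2 * c := by
    rw [abs_div, abs_of_pos hr0, div_le_iff₀ hr0, abs_sub_comm]
    nlinarith [hr.1]
  have h3 : |p' / r'| ≤ 3 := by
    rw [abs_div, abs_of_pos hr0', div_le_iff₀ hr0', abs_of_nonneg (by linarith [hp'.1])]
    linarith [hp'.2, hr'.1]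
  rw [e]
  calc _ ≤ |(p - p') / r| + |p' / r' * ((r' - r) / r)| := abs_add_le _ _
    _ ≤ 2 * c + 3 * (2 * c) := by
        rw [abs_mul]
        exact add_le_add h1 (mul_le_mul h3 h2 (abs_nonneg _) (by norm_num))
    _ = 8 * c := by ring

lemma hasCondDistrib_of_lintegral {Ω α β : Type*} [MeasurableSpace Ω] [MeasurableSpace α]
    [MeasurableSpace β] {μ : Measure Ω} [SFinite μ] {S : Ω → α} {T : Ω → β} (hS : Measurable S)
    (hT : Measurable T) {κ : Kernel α β} [IsMarkovKernel κ]
    (h : ∀ F : α × β → ℝ≥0∞, Measurable F →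
      ∫⁻ x, F (S x, T x) ∂μ = ∫⁻ x, ∫⁻ t, F (S x, t) ∂(κ (S x)) ∂μ) :
    HasCondDistrib T S κ μ := by
  refine ⟨(hS.prodMk hT).aemeasurable, Measure.ext_of_lintegral _ fun F hF => ?_⟩
  rw [lintegral_map hF (hS.prodMk hT), Measure.lintegral_compProd hF, lintegral_map _ hS, h F hF]
  exact Measurable.lintegral_kernel_prod_right' hF

/-- Under `u` the variables `S` and `T` are independent. Averaging `q` over everything else gives
their joint density `P` with respect to `ρ ⊗ τ`, with marginal density `R` of `S`. Both inherit the
bounds of `q` and its Lipschitz constant in `s`, so the conditional density `P (s, t) / R s` is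
defined and Lipschitz in `s` for every `s`, including values that `S` never takes. -/
theorem hasTVLipCondDistrib_withDensity {Ω α β : Type*} [MeasurableSpace Ω] [MeasurableSpace α]
    [MeasurableSpace β] [PseudoMetricSpace Ω] [PseudoMetricSpace α] [PseudoMetricSpace β]
    {u : Measure Ω} [IsProbabilityMeasure u] {S : Ω → α} {T : Ω → β} {ρ : Measure α}
    {τ : Measure β} [IsProbabilityMeasure ρ] [IsProbabilityMeasure τ] {mS : α → Ω → Ω}
    {mT : β → Ω → Ω} (hS : IsResampling u S ρ mS) (hT : IsResampling u T τ mT)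
    (hTS : ∀ s x, T (mS s x) = T x) {q : Ω → ℝ} (hq : Measurable q)
    (hqb : ∀ x, q x ∈ Set.Icc (1 / 2 : ℝ) (3 / 2)) {Λ : ℝ} (hΛ : 0 ≤ Λ)
    (hqΛ : ∀ x y, |q x - q y| ≤ Λ * dist x y) {L : ℝ} (hL : 4 * Λ ≤ L) :
    HasTVLipCondDistrib L T S (u.withDensity fun x => ENNReal.ofReal (q x)) := by
  have hSm := hS.measurable_uncurry
  have hTm := hT.measurable_uncurry
  have hq3 : Measurable fun z : (α × β) × Ω => q (mS z.1.1 (mT z.1.2 z.2)) :=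
    hq.comp (hSm.comp ((measurable_fst.comp measurable_fst).prodMk
      (hTm.comp ((measurable_snd.comp measurable_fst).prodMk measurable_snd))))
  let P : α × β → ℝ := fun z => ∫ x, q (mS z.1 (mT z.2 x)) ∂u
  have hPm : Measurable P := (hq3.stronglyMeasurable.integral_prod_right (ν := u)).measurable
  have hq1 : ∀ s t, Measurable fun x => q (mS s (mT t x)) := fun s t =>
    hq3.comp (measurable_prodMk_left (x := (s, t)))
  have hPb : ∀ z, P z ∈ Set.Icc (1 / 2 : ℝ) (3 / 2) := fun z =>
    integral_mem_Icc (hq1 _ _) fun x => hqb _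
  have hPof : ∀ s t, ENNReal.ofReal (P (s, t)) =
      ∫⁻ x, ENNReal.ofReal (q (mS s (mT t x))) ∂u := fun s t =>
    ofReal_integral_eq_lintegral_ofReal (integrable_of_mem_Icc (hq1 s t) fun x => hqb _)
      (ae_of_all _ fun x => by have := (hqb (mS s (mT t x))).1; simp only [Pi.zero_apply]; linarith)
  have hPL : ∀ s s' t, |P (s, t) - P (s', t)| ≤ Λ * dist s s' := fun s s' t =>
    integral_sub_integral_le (integrable_of_mem_Icc (hq1 _ _) fun x => hqb _)
      (integrable_of_mem_Icc (hq1 _ _) fun x => hqb _) fun x =>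
      (hqΛ _ _).trans (mul_le_mul_of_nonneg_left (hS.dist_left _ _ _) hΛ)
  let R : α → ℝ := fun s => ∫ t, P (s, t) ∂τ
  have hRm : Measurable R := (hPm.stronglyMeasurable.integral_prod_right (ν := τ)).measurable
  have hP1 : ∀ s, Measurable fun t => P (s, t) := fun s => hPm.comp measurable_prodMk_left
  have hRb : ∀ s, R s ∈ Set.Icc (1 / 2 : ℝ) (3 / 2) := fun s =>
    integral_mem_Icc (hP1 s) fun t => hPb _
  have hRL : ∀ s s', |R s - R s'| ≤ Λ * dist s s' := fun s s' =>
    integral_sub_integral_le (integrable_of_mem_Icc (hP1 _) fun x => hPb _)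
      (integrable_of_mem_Icc (hP1 _) fun x => hPb _) fun t => hPL s s' t
  have hR0 : ∀ s, 0 < R s := fun s => by linarith [(hRb s).1]
  have hP0 : ∀ z, 0 < P z := fun z => by linarith [(hPb z).1]
  have hdm : Measurable (Function.uncurry fun s t => ENNReal.ofReal (P (s, t) / R s)) := by
    have : Measurable fun z : α × β => ENNReal.ofReal (P z / R z.1) := by fun_prop
    exact this
  let κ : Kernel α β := (Kernel.const α τ).withDensity fun s t => ENNReal.ofReal (P (s, t) / R s)
  have hκ : ∀ s, κ s = τ.withDensity fun t => ENNReal.ofReal (P (s, t) / R s) := fun s => by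
    rw [Kernel.withDensity_apply _ hdm, Kernel.const_apply]
  have hdm1 : ∀ s, Measurable fun t => ENNReal.ofReal (P (s, t) / R s) := fun s =>
    hdm.comp measurable_prodMk_left
  have hPi : ∀ s, Integrable (fun t => P (s, t)) τ := fun s =>
    integrable_of_mem_Icc (hP1 s) fun t => hPb _
  have hRof : ∀ s, ∫⁻ t, ENNReal.ofReal (P (s, t)) ∂τ = ENNReal.ofReal (R s) := fun s =>
    (ofReal_integral_eq_lintegral_ofReal (hPi s) (ae_of_all _ fun t => (hP0 _).le)).symm
  have hκM : IsMarkovKernel κ := by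
    refine ⟨fun s => ⟨?_⟩⟩
    rw [hκ, withDensity_apply _ MeasurableSet.univ, Measure.restrict_univ,
      ← ofReal_integral_eq_lintegral_ofReal ((hPi s).div_const _)
        (ae_of_all _ fun t => (div_pos (hP0 _) (hR0 _)).le), integral_div, div_self (hR0 s).ne',
      ENNReal.ofReal_one]
  -- Resample `S`, then `T`: since `mS` leaves `T` alone, `F` becomes a constant factor and only `q`
  -- is averaged.
  have hform : ∀ F : α × β → ℝ≥0∞, Measurable F →
      ∫⁻ x, F (S x, T x) ∂(u.withDensity fun x => ENNReal.ofReal (q x)) =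
        ∫⁻ s, ∫⁻ t, F (s, t) * ENNReal.ofReal (P (s, t)) ∂τ ∂ρ := by
    intro F hF
    have hST := hS.measurable.prodMk hT.measurable
    have hFq : Measurable fun x => F (S x, T x) * ENNReal.ofReal (q x) :=
      (hF.comp hST).mul hq.ennreal_ofReal
    rw [lintegral_withDensity_eq_lintegral_mul _ hq.ennreal_ofReal 
      (show Measurable fun x => F (S x, T x) from hF.comp hST)]
    have h1 : ∀ x, ((fun x => ENNReal.ofReal (q x)) * fun x => F (S x, T x)) x =
        F (S x, T x) * ENNReal.ofReal (q x) := fun x => mul_comm _ _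
    simp_rw [h1]
    rw [← hS.lintegral _ hFq]
    refine lintegral_congr fun s => ?_
    simp_rw [hS.apply, hTS]
    rw [← hT.lintegral (fun x => F (s, T x) * ENNReal.ofReal (q (mS s x)))
      ((hF.comp (measurable_const.prodMk hT.measurable)).mul
        (hq.comp (hSm.comp measurable_prodMk_left)).ennreal_ofReal)]
    refine lintegral_congr fun t => ?_
    simp_rw [hT.apply]
    rw [lintegral_const_mul _ (hq1 s t).ennreal_ofReal, hPof]
  have : IsFiniteMeasure (u.withDensity fun x => ENNReal.ofReal (q x)) :=
    isFiniteMeasure_withDensity_ofReal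
      (integrable_of_mem_Icc (u := u) hq hqb).hasFiniteIntegral
  refine ⟨κ, hκM, ?_, fun s s' => ?_⟩
  · refine hasCondDistrib_of_lintegral hS.measurable hT.measurable fun F hF => ?_
    have hG : Measurable fun s => ∫⁻ t, F (s, t) ∂(κ s) :=
      Measurable.lintegral_kernel_prod_right' hF
    rw [hform F hF, hform (fun z => ∫⁻ t, F (z.1, t) ∂(κ z.1)) (hG.comp measurable_fst)]
    refine lintegral_congr fun s => ?_
    dsimp only
    have hFs : Measurable fun t => F (s, t) := hF.comp measurable_prodMk_left
    rw [lintegral_const_mul _ (hP1 s).ennreal_ofReal, hRof, hκ,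
      lintegral_withDensity_eq_lintegral_mul _ (hdm1 s) hFs,
      ← lintegral_mul_const _ ((hdm1 s).mul hFs)]
    refine lintegral_congr fun t => ?_
    simp only [Pi.mul_apply]
    rw [mul_right_comm, ← ENNReal.ofReal_mul (div_pos (hP0 _) (hR0 _)).le,
      div_mul_cancel₀ _ (hR0 s).ne', mul_comm]
  · have hd : 0 ≤ dist s s' := dist_nonneg
    have : Nonempty {f : β → ℝ // Measurable f ∧ ∀ x, |f x| ≤ 1 / 2} :=
      ⟨⟨fun _ => 0, measurable_const, fun _ => by norm_num⟩⟩
    refine ciSup_le fun ⟨f, hf, hfb⟩ => ?_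
    have hint : ∀ s, ∫ t, f t ∂(κ s) = ∫ t, P (s, t) / R s * f t ∂τ := by
      intro s
      rw [hκ, integral_withDensity_eq_integral_toReal_smul (hdm1 s)
        (ae_of_all _ fun t => ENNReal.ofReal_lt_top)]
      simp_rw [smul_eq_mul, ENNReal.toReal_ofReal (div_pos (hP0 _) (hR0 _)).le]
    have hi : ∀ s, Integrable (fun t => P (s, t) / R s * f t) τ := fun s =>
      ((hPi s).div_const _).mul_bdd (c := 1 / 2) hf.aestronglyMeasurable
        (ae_of_all _ fun t => hfb t)
    simp only [hint]
    refine (le_abs_self _).trans ((integral_sub_integral_le (hi s) (hi s')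
      (c := 4 * Λ * dist s s') fun t => ?_).trans (mul_le_mul_of_nonneg_right hL hd))
    rw [← sub_mul, abs_mul]
    have := mul_le_mul (abs_div_sub_div_le (hPb (s', t)) (hRb s) (hRb s') (hPL s s' t) (hRL s s'))
      (hfb t) (abs_nonneg _) (by positivity)
    linarith

/-! ### Resampling blocks of coordinates of a product measure. -/

section Resampling

variable {K : ℕ} {d : Fin K → ℕ} (ν : ∀ k, Measure (Fin (d k) → unitInterval))
  [∀ k, IsProbabilityMeasure (ν k)]

/-- Fubini, together with the fact that integrating out `J` a second time against probability
measures changes nothing. -/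
lemma lintegral_lmarginal (J : Finset (Fin K)) {F : Space d → ℝ≥0∞} (hF : Measurable F) :
    ∫⁻ x, lmarginal ν J F x ∂(Measure.pi ν) = ∫⁻ x, F x ∂(Measure.pi ν) := by
  have x₀ : Space d := fun _ _ => 0
  have hidem : lmarginal ν J (lmarginal ν J F) = lmarginal ν J F := by
    ext x
    have : ∀ y, lmarginal ν J F (Function.updateFinset x J y) = lmarginal ν J F x := by
      intro y
      refine lmarginal_congr ν F fun i hi => ?_
      simp [Function.updateFinset, hi]
    rw [lmarginal]
    simp [this]
  have hu : (Finset.univ : Finset (Fin K)) = Jᶜ ∪ J := by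
    ext i; by_cases h : i ∈ J <;> simp [h]
  have hd : Disjoint Jᶜ J := disjoint_compl_left
  rw [lintegral_eq_lmarginal_univ x₀, lintegral_eq_lmarginal_univ x₀, hu,
    lmarginal_union ν _ (hF.lmarginal ν) hd, lmarginal_union ν _ hF hd, hidem]

lemma isResampling_restrict (J : Finset (Fin K)) :
    IsResampling (Measure.pi ν) (J.restrict : Space d → SubSpace d J)
      (Measure.pi fun i : J => ν i) (fun s x => Function.updateFinset x J s) where
  measurable := Finset.measurable_restrict J
  measurable_uncurry := measurable_updateFinset'.comp measurable_swap
  lintegral F hF := by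
    have hm : Measurable (Function.uncurry fun (s : SubSpace d J) (x : Space d) =>
        F (Function.updateFinset x J s)) := hF.comp (measurable_updateFinset'.comp measurable_swap)
    rw [lintegral_lintegral_swap hm.aemeasurable]
    exact lintegral_lmarginal ν J hF
  apply s x := by ext i; simp [Function.updateFinset]
  dist_left s s' x := by
    refine (dist_pi_le_iff dist_nonneg).2 fun i => ?_
    by_cases hi : i ∈ J
    · simpa [Function.updateFinset, hi] using dist_le_pi_dist s s' ⟨i, hi⟩
    · simp [Function.updateFinset, hi]

lemma isResampling_eval (k : Fin K) :
    IsResampling (Measure.pi ν) (fun x : Space d => x k) (ν k)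
      (fun y x => Function.update x k y) where
  measurable := measurable_pi_apply k
  measurable_uncurry := measurable_update'.comp measurable_swap
  lintegral F hF := by
    have hm : Measurable (Function.uncurry fun (y : Fin (d k) → unitInterval) (x : Space d) =>
        F (Function.update x k y)) := hF.comp (measurable_update'.comp measurable_swap)
    rw [lintegral_lintegral_swap hm.aemeasurable,
      ← lintegral_lmarginal ν {k} hF, lmarginal_singleton]
  apply s x := by simp
  dist_left s s' x := by
    refine (dist_pi_le_iff dist_nonneg).2 fun i => ?_
    by_cases hi : i = k
    · subst hi; simp
    · simp [Function.update_of_ne hi]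

lemma restrict_updateFinset_of_disjoint {I J : Finset (Fin K)} (h : Disjoint I J) (x : Space d)
    (s : SubSpace d J) : I.restrict (Function.updateFinset x J s) = I.restrict x := by
  ext1 i
  simp [Function.updateFinset, Finset.disjoint_left.1 h i.2]

lemma restrict_update_of_notMem {I : Finset (Fin K)} {k : Fin K} (h : k ∉ I) (x : Space d)
    (y : Fin (d k) → unitInterval) : I.restrict (Function.update x k y) = I.restrict x := by
  ext1 i
  have : (i : Fin K) ≠ k := fun e => h (e ▸ i.2)
  simp [Function.update_of_ne this]

end Resampling

/-! ### Iterated integrals over the nodes of a sorted graph. -/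

section IteratedIntegral

variable {K : ℕ} {d : Fin K → ℕ} {G : Digraph (Fin K)}
  {κ : (k : Fin K) → Kernel (SubSpace d (pa G k)) (Fin (d k) → unitInterval)}

lemma IsTopSorted.notMem_pa (hG : IsTopSorted G) {k l : Fin K} (h : k ≤ l) : l ∉ pa G k := by
  simp only [pa, Finset.mem_filter, Finset.mem_univ, true_and]
  exact fun hadj => absurd (hG l k hadj) (not_lt.2 h)

lemma integrateNode_eq_self [∀ k, IsMarkovKernel (κ k)] {k : Fin K} {f : Space d → ℝ≥0∞}
    (hf : ∀ x y, f (Function.update x k y) = f x) : integrateNode κ k f = f := by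
  ext x
  simp [integrateNode, hf]

lemma foldr_integrateNode_eq_self [∀ k, IsMarkovKernel (κ k)] {l : List (Fin K)}
    {f : Space d → ℝ≥0∞} (hf : ∀ k ∈ l, ∀ x y, f (Function.update x k y) = f x) :
    l.foldr (integrateNode κ) f = f := by
  induction l with
  | nil => rfl
  | cons k l ih =>
    rw [List.foldr_cons, ih fun j hj => hf j (List.mem_cons_of_mem _ hj)]
    exact integrateNode_eq_self (hf k List.mem_cons_self)

lemma exists_finRange_eq_append (k : Fin K) :
    ∃ l₁ l₂ : List (Fin K), List.finRange K = l₁ ++ k :: l₂ ∧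
      (∀ j ∈ l₁, j < k) ∧ ∀ j ∈ l₂, k < j := by
  obtain ⟨l₁, l₂, h⟩ := List.append_of_mem (List.mem_finRange k)
  have hp := List.pairwise_lt_finRange K
  rw [h, List.pairwise_append, List.pairwise_cons] at hp
  exact ⟨l₁, l₂, h, fun j hj => hp.2.2 j hj k List.mem_cons_self, hp.2.1.1⟩

/-- The kernels of an iterated integral are conditional distributions given the parents. -/
lemma hasCondDistrib_of_iteratedIntegral (hG : IsTopSorted G) [∀ k, IsMarkovKernel (κ k)]
    {μ : Measure (Space d)} [SFinite μ]
    (hμ : ∀ f : Space d → ℝ≥0∞, Measurable f → ∀ x₀, ∫⁻ x, f x ∂μ = iteratedIntegral κ f x₀)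
    (k : Fin K) : HasCondDistrib (fun x : Space d => x k) (pa G k).restrict (κ k) μ := by
  refine hasCondDistrib_of_lintegral (Finset.measurable_restrict _) (measurable_pi_apply k)
    fun F hF => ?_
  have x₀ : Space d := fun _ _ => 0
  obtain ⟨l₁, l₂, hl, -, h₂⟩ := exists_finRange_eq_append k
  have hF' : Measurable fun s => ∫⁻ t, F (s, t) ∂(κ k s) :=
    Measurable.lintegral_kernel_prod_right' hF
  rw [hμ (fun x => F ((pa G k).restrict x, x k))
      (hF.comp ((Finset.measurable_restrict _).prodMk (measurable_pi_apply k))) x₀,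
    hμ (fun x => ∫⁻ t, F ((pa G k).restrict x, t) ∂(κ k ((pa G k).restrict x)))
      (hF'.comp (Finset.measurable_restrict _)) x₀]
  simp only [iteratedIntegral, hl, List.foldr_append, List.foldr_cons]
  -- Neither integrand depends on nodes after `k`, which therefore integrate out. Node `k` turns the
  -- first integrand into the second and leaves the second unchanged; the nodes before `k` then see
  -- the same function.
  have e₁ : l₂.foldr (integrateNode κ) (fun x => F ((pa G k).restrict x, x k)) = _ :=
    foldr_integrateNode_eq_self fun j hj x y => by
      rw [restrict_update_of_notMem (hG.notMem_pa (h₂ j hj).le),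
        Function.update_of_ne (h₂ j hj).ne]
  have e₂ : l₂.foldr (integrateNode κ)
      (fun x => ∫⁻ t, F ((pa G k).restrict x, t) ∂(κ k ((pa G k).restrict x))) = _ :=
    foldr_integrateNode_eq_self fun j hj x y => by
      rw [restrict_update_of_notMem (hG.notMem_pa (h₂ j hj).le)]
  have e₃ : integrateNode κ k (fun x => F ((pa G k).restrict x, x k)) =
      fun x => ∫⁻ t, F ((pa G k).restrict x, t) ∂(κ k ((pa G k).restrict x)) := by
    ext x
    simp only [integrateNode, restrict_update_of_notMem (hG.notMem_pa le_rfl),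
      Function.update_self]
  have e₄ : integrateNode κ k
      (fun x => ∫⁻ t, F ((pa G k).restrict x, t) ∂(κ k ((pa G k).restrict x))) = _ :=
    integrateNode_eq_self fun x y => by
      rw [restrict_update_of_notMem (hG.notMem_pa le_rfl)]
  rw [e₁, e₂, e₃, e₄]

lemma foldr_integrateNode_const (ν : ∀ k, Measure (Fin (d k) → unitInterval))
    [∀ k, IsProbabilityMeasure (ν k)] {f : Space d → ℝ≥0∞} (hf : Measurable f)
    {l : List (Fin K)} (hl : l.Nodup) :
    l.foldr (integrateNode (G := G) fun k => Kernel.const _ (ν k)) f =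
      lmarginal ν l.toFinset f := by
  induction l with
  | nil => simp
  | cons k l ih =>
    rw [List.nodup_cons] at hl
    ext x
    rw [List.foldr_cons, ih hl.2, List.toFinset_cons, lmarginal_insert _ hf (by simpa using hl.1)]
    simp [integrateNode]

lemma iteratedIntegral_const (ν : ∀ k, Measure (Fin (d k) → unitInterval))
    [∀ k, IsProbabilityMeasure (ν k)] {f : Space d → ℝ≥0∞} (hf : Measurable f) (x₀ : Space d) :
    iteratedIntegral (G := G) (fun k => Kernel.const _ (ν k)) f x₀ =
      ∫⁻ x, f x ∂(Measure.pi ν) := by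
  rw [iteratedIntegral, foldr_integrateNode_const ν hf (List.nodup_finRange K),
    List.toFinset_finRange, lmarginal_univ]

lemma foldr_integrateNode_congr
    {κ' : (k : Fin K) → Kernel (SubSpace d (pa G k)) (Fin (d k) → unitInterval)}
    {l : List (Fin K)} (h : ∀ k ∈ l, κ k = κ' k) (f : Space d → ℝ≥0∞) :
    l.foldr (integrateNode κ) f = l.foldr (integrateNode κ') f := by
  induction l with
  | nil => rfl
  | cons k l ih =>
    rw [List.foldr_cons, List.foldr_cons, ih fun j hj => h j (List.mem_cons_of_mem _ hj)]
    ext x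
    rw [integrateNode, integrateNode, h k List.mem_cons_self]

/-- Finiteness of `q` allows the factor to be pulled out without measurability of the inner iterated
integral. -/
lemma foldr_integrateNode_mul {l : List (Fin K)} {q : Space d → ℝ≥0∞} (hq : ∀ x, q x ≠ ⊤)
    (h : ∀ k ∈ l, ∀ x y, q (Function.update x k y) = q x) (f : Space d → ℝ≥0∞) :
    l.foldr (integrateNode κ) (fun x => q x * f x) =
      fun x => q x * l.foldr (integrateNode κ) f x := by
  induction l with
  | nil => rfl
  | cons k l ih =>
    rw [List.foldr_cons, List.foldr_cons, ih fun j hj => h j (List.mem_cons_of_mem _ hj)]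
    ext x
    simp only [integrateNode, h k List.mem_cons_self]
    exact lintegral_const_mul' _ _ (hq x)

end IteratedIntegral

/-! ### Membership of the perturbed measures in the class. -/

section Membership

variable {K : ℕ} {d : Fin K → ℕ} {G : Digraph (Fin K)}

/-- Changing, in a product measure, the conditional law of one node given its parents gives a
graphical model. -/
lemma isGraphicalModel_withDensity (hG : IsTopSorted G)
    (ν : ∀ k, Measure (Fin (d k) → unitInterval)) [∀ k, IsProbabilityMeasure (ν k)] (k : Fin K)
    {w : SubSpace d (pa G k) × (Fin (d k) → unitInterval) → ℝ≥0∞} (hw : Measurable w)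
    (hwt : ∀ z, w z ≠ ⊤) (hw1 : ∀ s, ∫⁻ y, w (s, y) ∂(ν k) = 1) :
    IsGraphicalModel G ((Measure.pi ν).withDensity fun x => w ((pa G k).restrict x, x k)) := by
  let κ₀ : (l : Fin K) → Kernel (SubSpace d (pa G l)) (Fin (d l) → unitInterval) :=
    fun l => Kernel.const _ (ν l)
  let κk : Kernel (SubSpace d (pa G k)) (Fin (d k) → unitInterval) :=
    (κ₀ k).withDensity fun s y => w (s, y)
  have hκk : ∀ s, κk s = (ν k).withDensity fun y => w (s, y) := fun s => by
    rw [Kernel.withDensity_apply _ (show Measurable (Function.uncurry fun s y => w (s, y)) from hw),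
      Kernel.const_apply]
  let κ := Function.update κ₀ k κk
  have hκ : ∀ l, IsMarkovKernel (κ l) := by
    intro l
    by_cases hl : l = k
    · subst hl
      refine ⟨fun s => ⟨?_⟩⟩
      simp only [κ, Function.update_self]
      rw [hκk, withDensity_apply _ MeasurableSet.univ, Measure.restrict_univ, hw1]
    · simp only [κ, Function.update_of_ne hl]
      infer_instance
  let q : Space d → ℝ≥0∞ := fun x => w ((pa G k).restrict x, x k)
  have hq : Measurable q :=
    hw.comp ((Finset.measurable_restrict _).prodMk (measurable_pi_apply k))
  have hfin : SFinite ((Measure.pi ν).withDensity q) := inferInstance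
  have hiter : ∀ f : Space d → ℝ≥0∞, Measurable f → ∀ x₀,
      ∫⁻ x, f x ∂((Measure.pi ν).withDensity q) = iteratedIntegral κ f x₀ := by
    intro f hf x₀
    rw [lintegral_withDensity_eq_lintegral_mul _ hq hf]
    have hconst := iteratedIntegral_const (G := G) ν (hq.mul hf) x₀
    rw [← hconst]
    obtain ⟨l₁, l₂, hl, h₁, h₂⟩ := exists_finRange_eq_append k
    simp only [iteratedIntegral, hl, List.foldr_append, List.foldr_cons]
    -- The density depends only on `x_k` and its parents, hence on no node after `k`. It passes
    -- through the integrals over `l₂` up to node `k`, where it becomes the density of the modified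
    -- kernel.
    have e₁ : ∀ f, l₁.foldr (integrateNode κ) f = l₁.foldr (integrateNode κ₀) f :=
      foldr_integrateNode_congr fun j hj => Function.update_of_ne (h₁ j hj).ne _ _
    have e₂ : ∀ f, l₂.foldr (integrateNode κ) f = l₂.foldr (integrateNode κ₀) f :=
      foldr_integrateNode_congr fun j hj => Function.update_of_ne (h₂ j hj).ne' _ _
    have e₃ : l₂.foldr (integrateNode κ₀) (q * f) =
        fun x => q x * l₂.foldr (integrateNode κ₀) f x :=
      foldr_integrateNode_mul (fun x => hwt _) (fun j hj x y => by
        rw [restrict_update_of_notMem (hG.notMem_pa (h₂ j hj).le),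
          Function.update_of_ne (h₂ j hj).ne]) f
    rw [e₁, e₂]
    refine congrFun (congrArg (fun g => l₁.foldr (integrateNode κ₀) g) ?_) x₀
    rw [e₃]
    ext x
    simp only [integrateNode, κ, Function.update_self, q, κ₀, Kernel.const_apply, hκk]
    have hws : Measurable fun y => w ((pa G k).restrict x, y) := hw.comp measurable_prodMk_left
    rw [lintegral_withDensity_eq_lintegral_mul_non_measurable _ hws
      (ae_of_all _ fun y => (hwt _).lt_top)]
    refine lintegral_congr fun y => ?_
    rw [Pi.mul_apply, restrict_update_of_notMem (hG.notMem_pa le_rfl)]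
  exact ⟨κ, hκ, fun l => hasCondDistrib_of_iteratedIntegral hG hiter l, hiter⟩

/-- A Lipschitz change of the conditional law of one node gives a TV-Lipschitz model. -/
theorem mem_tvLipModels (hG : IsTopSorted G)
    (ν : ∀ k, Measure (Fin (d k) → unitInterval)) [∀ k, IsProbabilityMeasure (ν k)] (k : Fin K)
    {w : SubSpace d (pa G k) × (Fin (d k) → unitInterval) → ℝ} (hw : Measurable w)
    (hwb : ∀ z, w z ∈ Set.Icc (1 / 2 : ℝ) (3 / 2)) (hw1 : ∀ s, ∫ y, w (s, y) ∂(ν k) = 1)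
    {Λ : ℝ} (hΛ : 0 ≤ Λ) (hwΛ : ∀ z z', |w z - w z'| ≤ Λ * dist z z') {L : ℝ} (hL : 4 * Λ ≤ L) :
    ∃ μ ∈ tvLipModels G d L, (μ : Measure (Space d)) = (Measure.pi ν).withDensity fun x =>
      ENNReal.ofReal (w ((pa G k).restrict x, x k)) := by
  have hw0 : ∀ z, 0 ≤ w z := fun z => by linarith [(hwb z).1]
  have hw1' : ∀ s, ∫⁻ y, ENNReal.ofReal (w (s, y)) ∂(ν k) = 1 := fun s => by
    have hws : Measurable fun y => w (s, y) := hw.comp measurable_prodMk_left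
    rw [← ofReal_integral_eq_lintegral_ofReal (integrable_of_mem_Icc hws fun y => hwb _)
      (ae_of_all _ fun y => hw0 _), hw1, ENNReal.ofReal_one]
  have hgm := isGraphicalModel_withDensity hG ν k hw.ennreal_ofReal
    (fun z => ENNReal.ofReal_ne_top) hw1'
  have hqm : Measurable fun x : Space d => w ((pa G k).restrict x, x k) :=
    hw.comp ((Finset.measurable_restrict _).prodMk (measurable_pi_apply k))
  have hqΛ : ∀ x y : Space d, |w ((pa G k).restrict x, x k) - w ((pa G k).restrict y, y k)| ≤
      Λ * dist x y := fun x y => by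
    refine (hwΛ _ _).trans (mul_le_mul_of_nonneg_left ?_ hΛ)
    rw [Prod.dist_eq]
    exact max_le ((dist_pi_le_iff dist_nonneg).2 fun i => dist_le_pi_dist x y i)
      (dist_le_pi_dist x y k)
  have hprob : IsProbabilityMeasure ((Measure.pi ν).withDensity fun x =>
      ENNReal.ofReal (w ((pa G k).restrict x, x k))) := by
    refine ⟨?_⟩
    obtain ⟨κ, hκ, hc, -⟩ := id hgm
    have := isFiniteMeasure_withDensity_ofReal
      (integrable_of_mem_Icc (u := Measure.pi ν) hqm fun x => hwb _).hasFiniteIntegral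
    rw [withDensity_apply _ MeasurableSet.univ, Measure.restrict_univ,
      ← (isResampling_eval ν k).lintegral _ hqm.ennreal_ofReal, lintegral_lintegral_swap]
    · simp [restrict_update_of_notMem (hG.notMem_pa le_rfl), hw1']
    · exact (hqm.comp (isResampling_eval ν k).measurable_uncurry).ennreal_ofReal.aemeasurable
  -- The node `l` is arbitrary, not only the modified `k`: all three kernels condition one block of
  -- coordinates on a disjoint one, and the density is Lipschitz in all coordinates jointly.
  refine ⟨⟨_, hprob⟩, ⟨hgm, fun l _ => ⟨?_, ?_, ?_⟩⟩, rfl⟩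
  · exact hasTVLipCondDistrib_withDensity (isResampling_restrict ν (pa G l))
      (isResampling_eval ν l)
      (fun s x => by simp [Function.updateFinset, hG.notMem_pa (le_refl l)])
      hqm (fun x => hwb _) hΛ hqΛ hL
  · exact hasTVLipCondDistrib_withDensity (isResampling_restrict ν (pa G l))
      (isResampling_restrict ν (pre G l))
      (fun s x => restrict_updateFinset_of_disjoint Finset.sdiff_disjoint x s)
      hqm (fun x => hwb _) hΛ hqΛ hL
  · exact hasTVLipCondDistrib_withDensity (isResampling_eval ν l)
      (isResampling_restrict ν (pa G l))
      (fun s x => restrict_update_of_notMem (hG.notMem_pa le_rfl) x s)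
      hqm (fun x => hwb _) hΛ hqΛ hL

end Membership

/-! ### Uniform distributions on finite grids and their products. -/

section GridMeasure

/-- The uniform distribution on a finite family of points. -/
def gridMeasure {A X : Type*} [Fintype A] [MeasurableSpace X] (p : A → X) : Measure X :=
  (Fintype.card A : ℝ≥0∞)⁻¹ • ∑ a, Measure.dirac (p a)

variable {A B X Y : Type*} [Fintype A] [Fintype B] [MeasurableSpace X] [MeasurableSpace Y]

lemma gridMeasure_apply (p : A → X) {s : Set X} (hs : MeasurableSet s) :
    gridMeasure p s = (Fintype.card A : ℝ≥0∞)⁻¹ * ∑ a, s.indicator 1 (p a) := by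
  simp [gridMeasure, Measure.dirac_apply' _ hs]

instance [Nonempty A] (p : A → X) : IsProbabilityMeasure (gridMeasure p) := by
  refine ⟨?_⟩
  rw [gridMeasure_apply p MeasurableSet.univ]
  simp only [Set.indicator_univ, Pi.one_apply, Finset.sum_const, Finset.card_univ, nsmul_eq_mul,
    mul_one]
  exact ENNReal.inv_mul_cancel (Nat.cast_ne_zero.2 Fintype.card_ne_zero)
    (ENNReal.natCast_ne_top _)

lemma integral_gridMeasure (p : A → X) {f : X → ℝ} (hf : Measurable f) :
    ∫ x, f x ∂(gridMeasure p) = (Fintype.card A : ℝ)⁻¹ * ∑ a, f (p a) := by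
  rw [gridMeasure, integral_smul_measure, integral_finsetSum_measure]
  · simp [integral_dirac' _ _ hf.stronglyMeasurable]
  · exact fun a _ => integrable_dirac' hf.stronglyMeasurable (by simp)

lemma gridMeasure_prod [Nonempty A] [Nonempty B] (p : A → X) (p' : B → Y) :
    (gridMeasure p).prod (gridMeasure p') =
      gridMeasure fun z : A × B => (p z.1, p' z.2) := by
  refine Measure.prod_eq fun s t hs ht => ?_
  rw [gridMeasure_apply _ (hs.prod ht), gridMeasure_apply _ hs, gridMeasure_apply _ ht,
    mul_mul_mul_comm, Finset.sum_mul_sum, ← Fintype.sum_prod_type', Fintype.card_prod,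
    Nat.cast_mul, ENNReal.mul_inv (by simp) (by simp)]
  congr 1
  refine Finset.sum_congr rfl fun z _ => ?_
  by_cases h : p z.1 ∈ s <;> by_cases h' : p' z.2 ∈ t <;> simp [h, h']

lemma gridMeasure_comp_equiv (e : B ≃ A) (p : A → X) :
    gridMeasure (p ∘ e) = gridMeasure p := by
  rw [gridMeasure, gridMeasure, Fintype.card_congr e]
  congr 1
  exact Equiv.sum_comp e fun a => Measure.dirac (p a)

lemma pi_gridMeasure {ι : Type*} [Fintype ι] [DecidableEq ι] {A X : ι → Type*} [∀ i, Fintype (A i)]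
    [∀ i, Nonempty (A i)] [∀ i, MeasurableSpace (X i)] (p : ∀ i, A i → X i) :
    Measure.pi (fun i => gridMeasure (p i)) =
      gridMeasure fun (a : ∀ i, A i) i => p i (a i) := by
  refine Measure.pi_eq fun s hs => ?_
  rw [gridMeasure_apply _ (MeasurableSet.univ_pi hs)]
  simp_rw [fun i => gridMeasure_apply (p i) (hs i)]
  rw [Finset.prod_mul_distrib, Finset.prod_univ_sum, Fintype.piFinset_univ, Fintype.card_pi,
    Nat.cast_prod, ENNReal.prod_inv_distrib (fun _ _ _ _ _ => Or.inr (ENNReal.natCast_ne_top _))]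
  congr 1
  refine Finset.sum_congr rfl fun a _ => ?_
  by_cases h : ∀ i, p i (a i) ∈ s i
  · rw [Set.indicator_of_mem (by simpa using h)]
    simp [h]
  · rw [Set.indicator_of_notMem (by simpa using h)]
    push Not at h
    obtain ⟨i, hi⟩ := h
    exact (Finset.prod_eq_zero (Finset.mem_univ i) (Set.indicator_of_notMem hi _)).symm

end GridMeasure

lemma sum_units_int {M : Type*} [AddCommMonoid M] (f : ℤˣ → M) : ∑ ε, f ε = f 1 + f (-1) := by
  rw [show (Finset.univ : Finset ℤˣ) = {1, -1} from rfl, Finset.sum_pair (by decide)]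

lemma abs_unit_cast (ε : ℤˣ) : |((ε : ℤ) : ℝ)| = 1 := by
  rcases Int.units_eq_one_or ε with h | h <;> simp [h]

/-! ### Sign perturbations of a uniform distribution and their minimax risk. -/

section SignDensity

variable {Y C : Type*} [PseudoMetricSpace Y] [Fintype C]

/-- The perturbation of the constant density `1` which moves mass between the two points
`pt (c, 1)` and `pt (c, -1)` of every cell `c`, in the direction given by `σ c`. -/
def signDensity (pt : C × ℤˣ → Y) (ρ δ : ℝ) (σ : C → ℤˣ) (y : Y) : ℝ :=
  1 + δ / ρ * ∑ i, (((σ i.1 : ℤ) : ℝ) * ((i.2 : ℤ) : ℝ)) * tent ρ (pt i) y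

variable {pt : C × ℤˣ → Y} {ρ δ : ℝ}

lemma abs_sign_mul_le {C : Type*} (σ : C → ℤˣ) (i : C × ℤˣ) :
    |((σ i.1 : ℤ) : ℝ) * ((i.2 : ℤ) : ℝ)| ≤ 1 := by
  rw [abs_mul, abs_unit_cast, abs_unit_cast, mul_one]

lemma measurable_signDensity [MeasurableSpace Y] [OpensMeasurableSpace Y] (σ : C → ℤˣ) :
    Measurable (signDensity pt ρ δ σ) := by
  have : Continuous (signDensity pt ρ δ σ) := by
    unfold signDensity
    have := fun i => continuous_tent (ρ := ρ) (pt i)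
    fun_prop
  exact this.measurable

lemma signDensity_mem_Icc (hρ : 0 < ρ) (hsep : ∀ i j, i ≠ j → 2 * ρ ≤ dist (pt i) (pt j))
    (hδ : 0 ≤ δ) (hδ' : δ ≤ 1 / 2) (σ : C → ℤˣ) (y : Y) :
    signDensity pt ρ δ σ y ∈ Set.Icc (1 / 2 : ℝ) (3 / 2) := by
  have h := abs_sum_tent_le hρ.le hsep (abs_sign_mul_le σ) y
  have h1 := mul_le_mul_of_nonneg_left h (div_nonneg hδ hρ.le)
  rw [div_mul_cancel₀ _ hρ.ne', ← abs_of_nonneg (div_nonneg hδ hρ.le), ← abs_mul, abs_le] at h1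
  unfold signDensity
  constructor <;> linarith [h1.1, h1.2]

lemma abs_signDensity_sub_le (hρ : 0 < ρ) (hsep : ∀ i j, i ≠ j → 2 * ρ ≤ dist (pt i) (pt j))
    (hδ : 0 ≤ δ) (σ : C → ℤˣ) (y z : Y) :
    |signDensity pt ρ δ σ y - signDensity pt ρ δ σ z| ≤ δ / ρ * dist y z := by
  unfold signDensity
  rw [add_sub_add_left_eq_sub, ← mul_sub, abs_mul, abs_of_nonneg (div_nonneg hδ hρ.le)]
  exact mul_le_mul_of_nonneg_left (abs_sum_tent_sub_le hsep (abs_sign_mul_le σ) y z)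
    (div_nonneg hδ hρ.le)

lemma tent_apply_eq_ite {C : Type*} [DecidableEq C] {pt : C × ℤˣ → Y} (hρ : 0 < ρ)
    (hsep : ∀ i j, i ≠ j → 2 * ρ ≤ dist (pt i) (pt j)) (i j : C × ℤˣ) :
    tent ρ (pt i) (pt j) = if i = j then ρ else 0 := by
  split_ifs with h
  · rw [h, tent_self hρ.le]
  · exact tent_eq_zero (by linarith [hsep j i (Ne.symm h)])

lemma signDensity_apply [DecidableEq C] (hρ : 0 < ρ)
    (hsep : ∀ i j, i ≠ j → 2 * ρ ≤ dist (pt i) (pt j)) (σ : C → ℤˣ) (i : C × ℤˣ) :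
    signDensity pt ρ δ σ (pt i) = 1 + δ * (((σ i.1 : ℤ) : ℝ) * ((i.2 : ℤ) : ℝ)) := by
  unfold signDensity
  simp only [tent_apply_eq_ite hρ hsep, mul_ite, mul_zero, Finset.sum_ite_eq', Finset.mem_univ,
    if_true]
  field_simp

variable {Ω : Type*} [MeasurableSpace Ω] [PseudoMetricSpace Ω] [MeasurableSpace Y]
  [OpensMeasurableSpace Y] [DecidableEq C] [Nonempty C]

/-- Minimax lower bound for models containing all sign perturbations of a uniform distribution
on well separated points. -/
theorem ofReal_le_minimaxRisk_of_signDensity (hρ : 0 < ρ)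
    (hsep : ∀ i j, i ≠ j → 2 * ρ ≤ dist (pt i) (pt j)) (hδ : 0 ≤ δ) (hδ' : δ ≤ 1 / 2)
    {u : Measure Ω} [IsProbabilityMeasure u] {π : Ω → Y} (hπm : Measurable π)
    (hπ : ∀ x y, dist (π x) (π y) ≤ dist x y) (hlaw : u.map π = gridMeasure pt)
    {Q : Set (ProbabilityMeasure Ω)}
    (hQ : ∀ σ, ∃ μ ∈ Q, (μ : Measure Ω) =
      u.withDensity fun x => ENNReal.ofReal (signDensity pt ρ δ σ (π x)))
    {n : ℕ} (hn : n * δ ^ 2 ≤ Fintype.card C / 2) :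
    ENNReal.ofReal (ρ * δ / 8) ≤ minimaxRisk Q n := by
  have hM : (0 : ℝ) < Fintype.card C := Nat.cast_pos.2 Fintype.card_pos
  -- Only the atoms matter for integrals, and there the tents take just the values `0` and `ρ`.
  have hint : ∀ {f : Y → ℝ}, Measurable f → ∫ x, f (π x) ∂u =
      (2 * Fintype.card C : ℝ)⁻¹ * ∑ c, (f (pt (c, 1)) + f (pt (c, -1))) := by
    intro f hf
    rw [← integral_map hπm.aemeasurable (f := f) (hf.aestronglyMeasurable), hlaw,
      integral_gridMeasure _ hf, Fintype.sum_prod_type]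
    simp_rw [sum_units_int]
    simp [Fintype.card_prod, mul_comm]
  let ψ : C → Ω → ℝ := fun c x => tent ρ (pt (c, 1)) (π x) - tent ρ (pt (c, -1)) (π x)
  have htm : ∀ i, Measurable (tent ρ (pt i)) := fun i => (continuous_tent _).measurable
  have hψs : ∀ (s : C → ℝ) x, ∑ c, s c * ψ c x =
      ∑ i : C × ℤˣ, (s i.1 * ((i.2 : ℤ) : ℝ)) * tent ρ (pt i) (π x) := by
    intro s x
    rw [Fintype.sum_prod_type]
    refine Finset.sum_congr rfl fun c _ => ?_
    rw [sum_units_int]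
    simp [ψ]
    ring
  have hqI := signDensity_mem_Icc hρ hsep hδ hδ'
  have key := ofReal_le_minimaxRisk_of_signs (Q := Q) (u := u) (ψ := ψ) (n := n)
    (fun c => ((htm _).comp hπm).sub ((htm _).comp hπm)) (B := ρ)
    (fun c x => abs_sub_le_of_nonneg_of_le (tent_nonneg _ _) (tent_le hρ.le _ _)
      (tent_nonneg _ _) (tent_le hρ.le _ _))
    (fun s hs x y => by
      rw [hψs, hψs]
      refine (abs_sum_tent_sub_le hsep (fun i => ?_) _ _).trans (hπ x y)
      rw [abs_mul, abs_unit_cast, mul_one]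
      exact hs _)
    (q := fun σ x => signDensity pt ρ δ σ (π x))
    (fun σ => (measurable_signDensity σ).comp hπm) (fun σ x => by linarith [(hqI σ (π x)).1])
    (fun σ x => (hqI σ (π x)).2) hQ (θ := ρ * δ / Fintype.card C) (by positivity)
    (fun σ c => ?_) (fun σ c => ?_)
  · convert key using 2
    field_simp
  · have h := hint (f := fun y => signDensity pt ρ δ σ y *
      (tent ρ (pt (c, 1)) y - tent ρ (pt (c, -1)) y))
      ((measurable_signDensity σ).mul ((htm _).sub (htm _)))
    refine h.trans ?_
    simp only [signDensity_apply hρ hsep, tent_apply_eq_ite hρ hsep]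
    rw [Finset.sum_eq_single c]
    · simp
      field_simp
      ring
    · intro b _ hb
      simp [hb.symm]
    · simp
  · obtain ⟨σ', hσ'⟩ : ∃ σ', σ' = σ * Pi.mulSingle c (-1) := ⟨_, rfl⟩
    have hne : ∀ b, b ≠ c → σ' b = σ b := fun b hb => by
      rw [hσ', Pi.mul_apply, Pi.mulSingle_eq_of_ne hb, mul_one]
    have hc : σ' c = -σ c := by
      rw [hσ', Pi.mul_apply, Pi.mulSingle_eq_same, mul_neg_one]
    rw [← hσ']
    clear hσ'
    have h := hint (f := fun y => √(signDensity pt ρ δ σ y *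
      signDensity pt ρ δ σ' y))
      ((measurable_signDensity σ).mul (measurable_signDensity _)).sqrt
    -- Outside the flipped cell the densities agree and the pair contributes `(1 + δ) + (1 - δ)`. In
    -- the flipped cell it contributes `2 √(1 - δ²)`, which is at least `2 (1 - δ²)`.
    have hlow : ∀ b, 2 - (if b = c then 2 * δ ^ 2 else 0) ≤
        √(signDensity pt ρ δ σ (pt (b, 1)) *
          signDensity pt ρ δ σ' (pt (b, 1))) +
        √(signDensity pt ρ δ σ (pt (b, -1)) *
          signDensity pt ρ δ σ' (pt (b, -1))) := by
      intro b
      simp only [signDensity_apply hρ hsep]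
      split_ifs with hb
      · subst hb
        have hs : 1 - δ ^ 2 ≤ √((1 + δ) * (1 - δ)) := by
          refine Real.le_sqrt_of_sq_le ?_
          have : 0 ≤ δ ^ 2 * (1 - δ ^ 2) := mul_nonneg (sq_nonneg _) (by nlinarith)
          linarith [show (1 + δ) * (1 - δ) - (1 - δ ^ 2) ^ 2 = δ ^ 2 * (1 - δ ^ 2) by ring]
        have hs' : 1 - δ ^ 2 ≤ √((1 - δ) * (1 + δ)) := by rwa [mul_comm (1 - δ)]
        rcases Int.units_eq_one_or (σ b) with e | e <;>
          simp only [hc, e, Units.val_one, Int.cast_one,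
            Units.val_neg, Int.cast_neg, mul_one, mul_neg, neg_neg,
            ← sub_eq_add_neg] <;> linarith
      · rw [hne b hb]
        rcases Int.units_eq_one_or (σ b) with e | e <;>
          simp only [e, Units.val_one, Int.cast_one, Units.val_neg, Int.cast_neg, mul_one, mul_neg,
            neg_neg] <;>
          rw [Real.sqrt_mul_self (by linarith), Real.sqrt_mul_self (by linarith)] <;> linarith
    have hge : 1 - δ ^ 2 / Fintype.card C ≤ ∫ x, √(signDensity pt ρ δ σ (π x) *
        signDensity pt ρ δ σ' (π x)) ∂u := by
      rw [h]
      refine le_trans (le_of_eq ?_) (mul_le_mul_of_nonneg_left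
        (Finset.sum_le_sum fun b _ => hlow b) (by positivity))
      rw [Finset.sum_sub_distrib, Finset.sum_ite_eq' , if_pos (Finset.mem_univ c),
        Finset.sum_const, Finset.card_univ, nsmul_eq_mul]
      field_simp
    have hδM : δ ^ 2 / Fintype.card C ≤ 1 := by
      rw [div_le_one hM]
      have : (1 : ℝ) ≤ Fintype.card C := Nat.one_le_cast.2 Fintype.card_pos
      nlinarith
    -- Bernoulli's inequality bounds the affinity of `n` observations below by `1 - n δ²/M`.
    have hb := one_add_mul_le_pow (a := -(δ ^ 2 / Fintype.card C)) (by linarith) n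
    have hn' : n * (δ ^ 2 / Fintype.card C) ≤ 1 / 2 := by
      rw [← mul_div_assoc, div_le_iff₀ hM]
      linarith
    calc (1 / 2 : ℝ) ≤ (1 + -(δ ^ 2 / Fintype.card C)) ^ n := by linarith
      _ ≤ _ := pow_le_pow_left₀ (by linarith) (by linarith) n

end SignDensity

/-! ### Grids in the unit cube -/

/-- The point `m / (2 r)` of the unit interval. -/
def gridCoord {r : ℕ} (m : Fin (2 * r)) : unitInterval :=
  ⟨(m : ℝ) / (2 * r), by positivity, by
    have hm : (m : ℝ) ≤ 2 * r := by exact_mod_cast m.2.le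
    exact div_le_one_of_le₀ hm (by positivity)⟩

/-- The spacing is `1/(2r)`; the tent radius `1/(4r)` used below is half of it. -/
lemma le_dist_gridCoord {r : ℕ} {m m' : Fin (2 * r)} (h : m ≠ m') :
    2 * (1 / (4 * (r : ℝ))) ≤ dist (gridCoord m) (gridCoord m') := by
  have hr : (0 : ℝ) < r := by
    have := m.pos
    exact_mod_cast (by omega : 0 < r)
  rw [Subtype.dist_eq, Real.dist_eq]
  simp only [gridCoord]
  rw [← sub_div, abs_div, abs_of_pos (by positivity : (0 : ℝ) < 2 * r), le_div_iff₀ (by positivity)]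
  have h1 : (1 : ℝ) ≤ |(m : ℝ) - m'| := by
    have : (1 : ℤ) ≤ |((m : ℕ) : ℤ) - ((m' : ℕ) : ℤ)| :=
      Int.one_le_abs (sub_ne_zero.2 fun e => h (Fin.ext (by exact_mod_cast e)))
    exact_mod_cast this
  calc 2 * (1 / (4 * (r : ℝ))) * (2 * r) = 1 := by field_simp; norm_num
    _ ≤ _ := h1

/-- The grid point of the cube whose coordinates are `i / r`. -/
def cubeGrid {e r : ℕ} (a : Fin e → Fin r) : Fin e → unitInterval :=
  fun j => gridCoord (r := r) ⟨2 * a j, by have := (a j).2; omega⟩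

/-- Two grid points for each cell of the cube, which differ in the coordinate `j₀` only. -/
def pairGrid {e r : ℕ} (j₀ : Fin e) (b : (Fin e → Fin r) × ℤˣ) : Fin e → unitInterval :=
  fun j => gridCoord (r := r) ⟨2 * b.1 j + if j = j₀ ∧ b.2 = -1 then 1 else 0, by
    have := (b.1 j).2
    split_ifs <;> omega⟩

lemma le_dist_cubeGrid {e r : ℕ} {a a' : Fin e → Fin r} (h : a ≠ a') :
    2 * (1 / (4 * (r : ℝ))) ≤ dist (cubeGrid a) (cubeGrid a') := by
  obtain ⟨j, hj⟩ := Function.ne_iff.1 h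
  refine le_trans ?_ (dist_le_pi_dist _ _ j)
  refine le_dist_gridCoord fun e => hj ?_
  rw [Fin.mk.injEq] at e
  exact Fin.ext (by omega)

/-- Halving the index `2 * b.1 j + (0 or 1)` recovers the cell, and its parity at `j₀` recovers the
sign. -/
lemma le_dist_pairGrid {e r : ℕ} (j₀ : Fin e) {b b' : (Fin e → Fin r) × ℤˣ} (h : b ≠ b') :
    2 * (1 / (4 * (r : ℝ))) ≤ dist (pairGrid j₀ b) (pairGrid j₀ b') := by
  by_cases hb : b.1 = b'.1
  · refine le_trans ?_ (dist_le_pi_dist _ _ j₀)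
    refine le_dist_gridCoord fun e => h ?_
    rw [Fin.mk.injEq, hb] at e
    refine Prod.ext hb ?_
    rcases Int.units_eq_one_or b.2 with h1 | h1 <;>
      rcases Int.units_eq_one_or b'.2 with h2 | h2 <;> simp [h1, h2] at e ⊢
  · obtain ⟨j, hj⟩ := Function.ne_iff.1 hb
    refine le_trans ?_ (dist_le_pi_dist _ _ j)
    refine le_dist_gridCoord fun e => hj ?_
    rw [Fin.mk.injEq] at e
    refine Fin.ext ?_
    split_ifs at e <;> omega

/-! ### Perturbations of one node -/

section OneNode

variable {A B Y₁ Y₂ : Type*} [PseudoMetricSpace Y₁] [PseudoMetricSpace Y₂] {p₁ : A → Y₁} {p₂ : B × ℤˣ → Y₂} {ρ δ : ℝ}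

/-- The points `(p₁ a, p₂ (b, ε))`, with cells `(a, b)`. -/
def prodPoint (p₁ : A → Y₁) (p₂ : B × ℤˣ → Y₂) : (A × B) × ℤˣ → Y₁ × Y₂ :=
  fun i => (p₁ i.1.1, p₂ (i.1.2, i.2))

lemma le_dist_prodPoint (hp₁ : ∀ a a', a ≠ a' → 2 * ρ ≤ dist (p₁ a) (p₁ a'))
    (hp₂ : ∀ b b', b ≠ b' → 2 * ρ ≤ dist (p₂ b) (p₂ b')) (i j : (A × B) × ℤˣ) (h : i ≠ j) :
    2 * ρ ≤ dist (prodPoint p₁ p₂ i) (prodPoint p₁ p₂ j) := by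
  rw [Prod.dist_eq]
  by_cases ha : i.1.1 = j.1.1
  · refine le_trans (hp₂ (i.1.2, i.2) (j.1.2, j.2) fun e => h ?_) (le_max_right _ _)
    rw [Prod.mk.injEq] at e
    exact Prod.ext (Prod.ext ha e.1) e.2
  · exact le_trans (hp₁ _ _ ha) (le_max_left _ _)

variable [Fintype A] [Fintype B] [MeasurableSpace Y₂]

/-- This is needed at every `s`, not only at grid points, since it makes the perturbed law a Markov
kernel. At an atom `p₂ j` a tent either vanishes or, by the sup-distance, equals the tent around `p₁
a` at `s`; the latter does not depend on the sign, so the two atoms of each cell cancel. -/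
lemma integral_signDensity_prodPoint [MeasurableSpace Y₁] [OpensMeasurableSpace (Y₁ × Y₂)]
    [Nonempty B] (hρ : 0 < ρ)
    (hp₂ : ∀ b b', b ≠ b' → 2 * ρ ≤ dist (p₂ b) (p₂ b')) (σ : A × B → ℤˣ) (s : Y₁) :
    ∫ y, signDensity (prodPoint p₁ p₂) ρ δ σ (s, y) ∂(gridMeasure p₂) = 1 := by
  classical
  rw [integral_gridMeasure p₂ (f := fun y => signDensity (prodPoint p₁ p₂) ρ δ σ (s, y))
    ((measurable_signDensity σ).comp measurable_prodMk_left)]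
  have ht : ∀ (i : (A × B) × ℤˣ) (j : B × ℤˣ), tent ρ (prodPoint p₁ p₂ i) (s, p₂ j) =
      if j = (i.1.2, i.2) then tent ρ (p₁ i.1.1) s else 0 := by
    intro i j
    split_ifs with h
    · simp [tent, prodPoint, Prod.dist_eq, h]
    · refine tent_eq_zero ?_
      rw [Prod.dist_eq]
      have h2 := hp₂ _ _ h
      exact le_trans (show ρ ≤ dist (p₂ j) (p₂ (i.1.2, i.2)) by linarith) (le_max_right _ _)
  have hsum : ∑ j, ∑ i : (A × B) × ℤˣ, (((σ i.1 : ℤ) : ℝ) * ((i.2 : ℤ) : ℝ)) *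
      tent ρ (prodPoint p₁ p₂ i) (s, p₂ j) = 0 := by
    rw [Finset.sum_comm]
    simp only [ht, mul_ite, mul_zero, Finset.sum_ite_eq', Finset.mem_univ, if_true]
    rw [Fintype.sum_prod_type]
    refine Finset.sum_eq_zero fun c _ => ?_
    rw [sum_units_int]
    simp
  simp only [signDensity]
  rw [Finset.sum_add_distrib, ← Finset.mul_sum, hsum]
  simp
  field_simp

lemma integral_signDensity_gridMeasure [OpensMeasurableSpace Y₂] [Nonempty B] (hρ : 0 < ρ)
    (hp₂ : ∀ b b', b ≠ b' → 2 * ρ ≤ dist (p₂ b) (p₂ b')) (σ : B → ℤˣ) :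
    ∫ y, signDensity p₂ ρ δ σ y ∂(gridMeasure p₂) = 1 := by
  classical
  rw [integral_gridMeasure p₂ (measurable_signDensity σ)]
  simp_rw [signDensity_apply hρ hp₂]
  have hsum : ∑ i : B × ℤˣ, ((σ i.1 : ℤ) : ℝ) * ((i.2 : ℤ) : ℝ) = 0 := by
    rw [Fintype.sum_prod_type]
    simp_rw [sum_units_int]
    simp
  rw [Finset.sum_add_distrib, ← Finset.mul_sum, hsum]
  simp
  field_simp

end OneNode

/-- Independence: resampling `S` does not affect `T`. -/
lemma map_prodMk_of_isResampling {Ω α β : Type*} [MeasurableSpace Ω] [MeasurableSpace α]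
    [MeasurableSpace β] [PseudoMetricSpace Ω] [PseudoMetricSpace α] [PseudoMetricSpace β]
    {u : Measure Ω} [IsProbabilityMeasure u] {S : Ω → α} {T : Ω → β} {ρ : Measure α}
    {τ : Measure β} [SFinite τ] {mS : α → Ω → Ω} {mT : β → Ω → Ω} (hS : IsResampling u S ρ mS)
    (hT : IsResampling u T τ mT) (hTS : ∀ s x, T (mS s x) = T x) :
    u.map (fun x => (S x, T x)) = ρ.prod τ := by
  have hST := hS.measurable.prodMk hT.measurable
  refine Measure.ext_of_lintegral _ fun F hF => ?_
  have hFST : Measurable fun x => F (S x, T x) := hF.comp hST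
  rw [lintegral_map hF hST, ← hS.lintegral _ hFST, lintegral_prod _ hF.aemeasurable]
  refine lintegral_congr fun s => ?_
  simp_rw [hS.apply, hTS]
  rw [← hT.lintegral (fun x => F (s, T x)) (hF.comp (measurable_const.prodMk hT.measurable))]
  simp [hT.apply]

/-! ### The two lower bounds -/

section LowerBounds

variable {K : ℕ} {d : Fin K → ℕ} {G : Digraph (Fin K)}

/-- The uniform distributions on the grids `{0, 1/r, …}` in all nodes except `k`, where the
finer grid `pairGrid` is used. -/
def nodeGrid (d : Fin K → ℕ) (r : ℕ) (k : Fin K) (j₀ : Fin (d k)) :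
    (l : Fin K) → Measure (Fin (d l) → unitInterval) :=
  Function.update (fun l => gridMeasure (cubeGrid (e := d l) (r := r))) k
    (gridMeasure (pairGrid (r := r) j₀))

lemma isProbabilityMeasure_nodeGrid {r : ℕ} (hr : 0 < r) {k : Fin K} (j₀ : Fin (d k))
    (l : Fin K) : IsProbabilityMeasure (nodeGrid d r k j₀ l) := by
  have : Nonempty (Fin r) := ⟨⟨0, hr⟩⟩
  by_cases hl : l = k
  · subst hl
    rw [nodeGrid, Function.update_self]
    infer_instance
  · rw [nodeGrid, Function.update_of_ne hl]
    infer_instance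

/-- The conditional law of node `k` given its parents is tilted. The constant is `ρδ/8` with `ρ =
1/(4r)` and `δ = Λρ`. -/
theorem ofReal_le_minimaxRisk_of_family (hG : IsTopSorted G) {k : Fin K} (j₀ : Fin (d k))
    {Λ L : ℝ} (hΛ : 0 < Λ) (hΛ' : Λ ≤ 1) (hL : 4 * Λ ≤ L) {r n : ℕ} (hr : 0 < r)
    (hn : n ≤ r ^ (dPa G d k + d k + 2)) :
    ENNReal.ofReal (Λ / (128 * (r : ℝ) ^ 2)) ≤ minimaxRisk (tvLipModels G d L) n := by
  have : Nonempty (Fin r) := ⟨⟨0, hr⟩⟩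
  have hr0 : (0 : ℝ) < r := Nat.cast_pos.2 hr
  have hr1 : (1 : ℝ) ≤ r := Nat.one_le_cast.2 hr
  have hprob := isProbabilityMeasure_nodeGrid (d := d) hr j₀
  let ν := nodeGrid d r k j₀
  let p₁ : ((l : pa G k) → Fin (d l) → Fin r) → SubSpace d (pa G k) := fun a l => cubeGrid (a l)
  let p₂ : (Fin (d k) → Fin r) × ℤˣ → Fin (d k) → unitInterval := pairGrid j₀
  have hρ : 0 < 1 / (4 * (r : ℝ)) := by positivity
  have hp₁ : ∀ a a', a ≠ a' → 2 * (1 / (4 * (r : ℝ))) ≤ dist (p₁ a) (p₁ a') := by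
    intro a a' h
    obtain ⟨l, hl⟩ := Function.ne_iff.1 h
    exact le_trans (le_dist_cubeGrid hl) (dist_le_pi_dist (p₁ a) (p₁ a') l)
  have hp₂ : ∀ b b', b ≠ b' → 2 * (1 / (4 * (r : ℝ))) ≤ dist (p₂ b) (p₂ b') :=
    fun b b' h => le_dist_pairGrid j₀ h
  have hsep := le_dist_prodPoint hp₁ hp₂
  -- The amplitude `δ = Λρ` gives the density the Lipschitz constant `δ/ρ = Λ`.
  have hδ : 0 ≤ Λ * (1 / (4 * (r : ℝ))) := by positivity
  have hρ4 : 1 / (4 * (r : ℝ)) ≤ 1 / 4 :=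
    one_div_le_one_div_of_le (by norm_num) (by linarith)
  have hδ' : Λ * (1 / (4 * (r : ℝ))) ≤ 1 / 2 := by nlinarith
  have hνk : ν k = gridMeasure p₂ := Function.update_self _ _ _
  have hνpa : (Measure.pi fun l : pa G k => ν l) = gridMeasure p₁ := by
    have h : (fun l : pa G k => ν l) = fun l : pa G k => gridMeasure (cubeGrid (r := r)) := by
      ext1 l
      refine Function.update_of_ne (fun e => ?_) _ _
      exact hG.notMem_pa (k := k) (l := l) e.ge l.2
    rw [h, pi_gridMeasure]
  have hlaw : (Measure.pi ν).map (fun x : Space d => ((pa G k).restrict x, x k)) =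
      gridMeasure (prodPoint p₁ p₂) := by
    rw [map_prodMk_of_isResampling (isResampling_restrict ν (pa G k)) (isResampling_eval ν k)
      (fun s x => by simp [Function.updateFinset, hG.notMem_pa (le_refl k)]), hνpa, hνk,
      gridMeasure_prod]
    exact (gridMeasure_comp_equiv (Equiv.prodAssoc _ _ _) _).symm
  have key := ofReal_le_minimaxRisk_of_signDensity (Q := tvLipModels G d L) (n := n) hρ hsep hδ
    hδ' ((Finset.measurable_restrict _).prodMk (measurable_pi_apply k))
    (fun x y => by
      rw [Prod.dist_eq]
      exact max_le ((dist_pi_le_iff dist_nonneg).2 fun i => dist_le_pi_dist x y i)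
        (dist_le_pi_dist x y k)) hlaw
    (fun σ => mem_tvLipModels hG ν k (measurable_signDensity σ)
      (signDensity_mem_Icc hρ hsep hδ hδ' σ)
      (fun s => by rw [hνk]; exact integral_signDensity_prodPoint hρ hp₂ σ s) hΛ.le
      (fun z z' => by
        have := abs_signDensity_sub_le hρ hsep hδ σ z z'
        rwa [mul_div_assoc, div_self hρ.ne', mul_one] at this) hL) ?_
  · convert key using 2
    field_simp
    norm_num
  · have hcard : Fintype.card (((l : pa G k) → Fin (d l) → Fin r) × (Fin (d k) → Fin r)) =
        r ^ (dPa G d k + d k) := by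
      rw [Fintype.card_prod, Fintype.card_pi]
      simp only [Fintype.card_fun, Fintype.card_fin]
      rw [Finset.prod_pow_eq_pow_sum, pow_add, dPa, ← Finset.sum_coe_sort (pa G k) d]
    rw [hcard, Nat.cast_pow]
    have hn' : (n : ℝ) ≤ (r : ℝ) ^ (dPa G d k + d k) * r ^ 2 := by
      rw [← pow_add]; exact_mod_cast hn
    have h16 : (Λ * (1 / (4 * (r : ℝ)))) ^ 2 ≤ 1 / (16 * r ^ 2) := by
      rw [mul_pow, div_pow, one_pow, mul_pow, show (4 : ℝ) ^ 2 = 16 by norm_num]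
      exact mul_le_of_le_one_left (by positivity) (pow_le_one₀ hΛ.le hΛ')
    calc (n : ℝ) * (Λ * (1 / (4 * (r : ℝ)))) ^ 2
        ≤ ((r : ℝ) ^ (dPa G d k + d k) * r ^ 2) * (1 / (16 * r ^ 2)) :=
          mul_le_mul hn' h16 (by positivity) (by positivity)
      _ = (r : ℝ) ^ (dPa G d k + d k) / 16 := by field_simp
      _ ≤ _ := by
        have : (0 : ℝ) < (r : ℝ) ^ (dPa G d k + d k) := by positivity
        linarith

/-- The marginal of node `k` in a product measure is tilted. The class imposes no smoothness on
marginals, so `δ = 1/2` for every `r`. -/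
theorem ofReal_le_minimaxRisk_of_node (hG : IsTopSorted G) {k : Fin K} (j₀ : Fin (d k))
    {L : ℝ} (hL : 0 ≤ L) {r n : ℕ} (hr : 0 < r) (hn : n ≤ r ^ d k) :
    ENNReal.ofReal (1 / (64 * (r : ℝ))) ≤ minimaxRisk (tvLipModels G d L) n := by
  have : Nonempty (Fin r) := ⟨⟨0, hr⟩⟩
  have hr0 : (0 : ℝ) < r := Nat.cast_pos.2 hr
  have hprob := isProbabilityMeasure_nodeGrid (d := d) hr j₀
  let ν := nodeGrid d r k j₀
  let p₂ : (Fin (d k) → Fin r) × ℤˣ → Fin (d k) → unitInterval := pairGrid j₀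
  have hρ : 0 < 1 / (4 * (r : ℝ)) := by positivity
  have hp₂ : ∀ b b', b ≠ b' → 2 * (1 / (4 * (r : ℝ))) ≤ dist (p₂ b) (p₂ b') :=
    fun b b' h => le_dist_pairGrid j₀ h
  have hνk : ν k = gridMeasure p₂ := Function.update_self _ _ _
  have hδ : (0 : ℝ) ≤ 1 / 2 := by norm_num
  have hqI := signDensity_mem_Icc hρ hp₂ hδ le_rfl
  have hQ : ∀ σ, ∃ μ ∈ tvLipModels G d L, (μ : Measure (Space d)) = (Measure.pi ν).withDensity
      fun x => ENNReal.ofReal (signDensity p₂ (1 / (4 * (r : ℝ))) (1 / 2) σ (x k)) := by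
    intro σ
    let g : (l : Fin K) → (Fin (d l) → unitInterval) → ℝ≥0∞ := Function.update (fun l _ => 1) k
      fun y => ENNReal.ofReal (signDensity p₂ (1 / (4 * (r : ℝ))) (1 / 2) σ y)
    have hgk : g k = fun y => ENNReal.ofReal (signDensity p₂ (1 / (4 * (r : ℝ))) (1 / 2) σ y) :=
      Function.update_self _ _ _
    have hgl : ∀ l, l ≠ k → g l = fun _ => 1 := fun l hl => Function.update_of_ne hl _ _
    have hg : ∀ l, Measurable (g l) := by
      intro l
      by_cases hl : l = k
      · subst hl
        rw [hgk]
        exact (measurable_signDensity σ).ennreal_ofReal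
      · rw [hgl l hl]
        exact measurable_const
    have hprob' : ∀ l, IsProbabilityMeasure ((ν l).withDensity (g l)) := by
      intro l
      refine ⟨?_⟩
      rw [withDensity_apply _ MeasurableSet.univ, Measure.restrict_univ]
      by_cases hl : l = k
      · subst hl
        rw [hgk, ← ofReal_integral_eq_lintegral_ofReal
          (integrable_of_mem_Icc (measurable_signDensity σ) (hqI σ))
          (ae_of_all _ fun y => by
            have := (hqI σ y).1
            simp only [Pi.zero_apply]
            linarith), hνk, integral_signDensity_gridMeasure hρ hp₂, ENNReal.ofReal_one]
      · rw [hgl l hl]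
        simp
    -- The tilt is absorbed into the base measures, so the conditional density is `w = 1`, with
    -- Lipschitz constant `0`.
    obtain ⟨μ, hμ, hμ'⟩ := mem_tvLipModels hG (fun l => (ν l).withDensity (g l)) k (Λ := 0)
      (w := fun _ => 1) measurable_const (fun _ => by norm_num) (fun s => by simp) le_rfl
      (fun z z' => by simp) (L := L) (by linarith)
    refine ⟨μ, hμ, ?_⟩
    have hprod : (fun x : Space d => ∏ l, g l (x l)) = fun x =>
        ENNReal.ofReal (signDensity p₂ (1 / (4 * (r : ℝ))) (1 / 2) σ (x k)) := by
      ext x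
      rw [Finset.prod_eq_single k (fun l _ hl => by rw [hgl l hl]) (by simp), hgk]
    rw [hμ', pi_withDensity ν hg, hprod]
    simp
  have key := ofReal_le_minimaxRisk_of_signDensity (n := n) hρ hp₂ hδ le_rfl
    (measurable_pi_apply k) (fun x y => dist_le_pi_dist x y k)
    (((measurePreserving_eval ν k).map_eq).trans hνk) hQ ?_
  · convert key using 2
    field_simp
    norm_num
  · have hcard : Fintype.card (Fin (d k) → Fin r) = r ^ d k := by simp
    have hn' : (n : ℝ) ≤ (r : ℝ) ^ d k := by exact_mod_cast hn
    have : (0 : ℝ) ≤ n := Nat.cast_nonneg n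
    rw [hcard, Nat.cast_pow]
    linarith

/-- Take the ceiling of `n^(1/m)`; rounding at most doubles it because `n^(1/m) ≥ 1`. -/
lemma exists_nat_root {n m : ℕ} (hn : 1 ≤ n) (hm : m ≠ 0) :
    ∃ r : ℕ, 0 < r ∧ n ≤ r ^ m ∧ (r : ℝ) ≤ 2 * (n : ℝ) ^ (1 / (m : ℝ)) := by
  have hn' : (1 : ℝ) ≤ n := Nat.one_le_cast.2 hn
  have hx : 1 ≤ (n : ℝ) ^ (1 / (m : ℝ)) := Real.one_le_rpow hn' (by positivity)
  refine ⟨⌈(n : ℝ) ^ (1 / (m : ℝ))⌉₊, Nat.ceil_pos.2 (by linarith), ?_, ?_⟩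
  · have h := pow_le_pow_left₀ (by linarith) (Nat.le_ceil ((n : ℝ) ^ (1 / (m : ℝ)))) m
    rw [← Real.rpow_natCast, ← Real.rpow_mul (by linarith), one_div,
      inv_mul_cancel₀ (Nat.cast_ne_zero.2 hm), Real.rpow_one] at h
    rw [one_div] at *
    exact_mod_cast h
  · linarith [Nat.ceil_lt_add_one (by linarith : 0 ≤ (n : ℝ) ^ (1 / (m : ℝ)))]

lemma exists_eq_dMax {k : Fin K} (hk : 2 ≤ d k) : ∃ l, 2 ≤ d l ∧ d l = dMax d := by
  obtain ⟨l, -, hl⟩ := Finset.exists_mem_eq_sup Finset.univ ⟨k, Finset.mem_univ k⟩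
    fun k => max 2 (d k)
  have hle : max 2 (d k) ≤ dMax d := Finset.le_sup (f := fun k => max 2 (d k)) (Finset.mem_univ k)
  change dMax d = max 2 (d l) at hl
  by_cases h : 2 ≤ d l
  · exact ⟨l, h, by rw [hl, max_eq_right h]⟩
  -- If the maximiser has dimension below `2`, the maximum is `2` and `k` attains it as well.
  · refine ⟨k, hk, ?_⟩
    rw [max_eq_right hk] at hle
    omega

end LowerBounds

end GraphicalModel
end

/-! ### Choice of the grid size and combination of the two rates. -/

theorem proposition1p3 (L₀ : ℝ) (hL₀ : 0 < L₀) :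
    ∃ C : ℝ, 0 < C ∧
      ∀ (L : ℝ), L₀ ≤ L → ∀ (K : ℕ) (G : Digraph (Fin K)) (d : Fin K → ℕ),
        GraphicalModel.IsTopSorted G →
        GraphicalModel.NoColliders G →
        (∃ k : Fin K, 2 ≤ d k ∧
          max 2 (d k) + GraphicalModel.dPa G d k = GraphicalModel.dLoc G d) →
        ∀ n : ℕ, 1 ≤ n →
          ENNReal.ofReal
              (C * ((n : ℝ) ^ (-(2 / (2 + (GraphicalModel.dLoc G d : ℝ)))) +
                (n : ℝ) ^ (-(1 / (GraphicalModel.dMax d : ℝ))))) ≤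
            GraphicalModel.minimaxRisk (GraphicalModel.tvLipModels G d L) n := by
  -- `L₀ / 4` ensures `4 * Λ ≤ L`; the cap `1` keeps the tilt `Λ/(4r)` below `1/2`.
  set Λ : ℝ := min (L₀ / 4) 1 with hΛ
  have hΛ0 : 0 < Λ := lt_min (by linarith) one_pos
  have hΛ1 : Λ ≤ 1 := min_le_right _ _
  have hΛL : 4 * Λ ≤ L₀ := by linarith [min_le_left (L₀ / 4) 1]
  -- With `r ≤ 2 n^(1/m)` the bounds `Λ/(128 r²)` and `1/(64 r)` yield the factors `Λ/512` and
  -- `1/128`. Since `Λ/512 ≤ 1/128` and the larger bound is at least half the sum, `Λ/1024` works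
  -- for both.
  refine ⟨Λ / 1024, by positivity, fun L hL K G d hG _ ⟨k, hk, hloc⟩ n hn => ?_⟩
  have hn0 : (0 : ℝ) < n := Nat.cast_pos.2 hn
  have hfamily : ENNReal.ofReal (Λ / 512 * (n : ℝ) ^ (-(2 / (2 + (GraphicalModel.dLoc G d : ℝ)))))
      ≤ GraphicalModel.minimaxRisk (GraphicalModel.tvLipModels G d L) n := by
    rw [max_eq_right hk] at hloc
    have hexp : GraphicalModel.dPa G d k + d k + 2 = 2 + GraphicalModel.dLoc G d := by omega
    obtain ⟨r, hr, hnr, hrn⟩ := GraphicalModel.exists_nat_root (m := 2 + GraphicalModel.dLoc G d)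
      hn (by omega)
    have hr0 : (0 : ℝ) < r := Nat.cast_pos.2 hr
    refine le_trans (ENNReal.ofReal_le_ofReal ?_)
      (GraphicalModel.ofReal_le_minimaxRisk_of_family (k := k) hG ⟨0, by omega⟩ hΛ0 hΛ1
        (hΛL.trans hL) hr (by rwa [hexp]))
    have hsq : (n : ℝ) ^ (2 / (2 + (GraphicalModel.dLoc G d : ℝ))) =
        ((n : ℝ) ^ (1 / ((2 + GraphicalModel.dLoc G d : ℕ) : ℝ))) ^ 2 := by
      rw [← Real.rpow_natCast, ← Real.rpow_mul hn0.le]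
      congr 1
      push_cast
      ring
    rw [Real.rpow_neg hn0.le, hsq]
    have hx : 0 < (n : ℝ) ^ (1 / ((2 + GraphicalModel.dLoc G d : ℕ) : ℝ)) :=
      Real.rpow_pos_of_pos hn0 _
    rw [← div_eq_mul_inv, div_div]
    refine div_le_div_of_nonneg_left hΛ0.le (by positivity) ?_
    have := pow_le_pow_left₀ hr0.le hrn 2
    nlinarith
  have hnode : ENNReal.ofReal (1 / 128 * (n : ℝ) ^ (-(1 / (GraphicalModel.dMax d : ℝ)))) ≤
      GraphicalModel.minimaxRisk (GraphicalModel.tvLipModels G d L) n := by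
    obtain ⟨l, hl, hmax⟩ := GraphicalModel.exists_eq_dMax hk
    obtain ⟨r, hr, hnr, hrn⟩ := GraphicalModel.exists_nat_root (m := d l) hn (by omega)
    have hr0 : (0 : ℝ) < r := Nat.cast_pos.2 hr
    refine le_trans (ENNReal.ofReal_le_ofReal ?_)
      (GraphicalModel.ofReal_le_minimaxRisk_of_node (k := l) hG ⟨0, by omega⟩
        (hL₀.le.trans hL) hr hnr)
    rw [← hmax, Real.rpow_neg hn0.le, ← div_eq_mul_inv, div_div]
    exact one_div_le_one_div_of_le (by positivity) (by linarith)
  rcases le_total (Λ / 512 * (n : ℝ) ^ (-(2 / (2 + (GraphicalModel.dLoc G d : ℝ)))))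
    (1 / 128 * (n : ℝ) ^ (-(1 / (GraphicalModel.dMax d : ℝ)))) with h | h
  · refine le_trans (ENNReal.ofReal_le_ofReal ?_) hnode
    have : Λ / 512 * (n : ℝ) ^ (-(1 / (GraphicalModel.dMax d : ℝ))) ≤
        1 / 128 * (n : ℝ) ^ (-(1 / (GraphicalModel.dMax d : ℝ))) :=
      mul_le_mul_of_nonneg_right (by linarith) (by positivity)
    linarith
  · refine le_trans (ENNReal.ofReal_le_ofReal ?_) hfamily
    have : Λ / 512 * (n : ℝ) ^ (-(1 / (GraphicalModel.dMax d : ℝ))) ≤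
        1 / 128 * (n : ℝ) ^ (-(1 / (GraphicalModel.dMax d : ℝ))) :=
      mul_le_mul_of_nonneg_right (by linarith) (by positivity)
    linarith
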